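/- Let $3<q\le 6$, let $\mathbb T^3=([-1,1]|_{\{-1;1\}})^3$ be the flat torus, and let $$X=W^{1,q}(\mathbb T^3)\times W^{2,2}(\mathbb T^3)\times W^{2,2}(\mathbb T^3;\mathbb R^3),\qquad \|(\varrho,\vartheta,\mathbf u)\|_X=\|\varrho\|_{W^{1,q}}+\|\vartheta\|_{W^{2,2}}+\|\mathbf u\|_{W^{2,2}},$$ where $\|v\|_{W^{k,p}}=\big(\sum_{|\alpha|\le k}\|D^\alpha v\|_{L^p}^p\big)^{1/p}$. Put $$X^+=\{(\varrho,\vartheta,\mathbf u)\in X:\ \|\varrho^{-1}\|_{C(\mathbb T^3)}<\infty,\ \|\vartheta^{-1}\|_{C(\mathbb T^3)}<\infty\},\qquad X^+_\infty=X^+\cup\{\mathbf U_\infty\},\quad \mathbf U_\infty=(0,0,0),$$ where $\|f^{-1}\|_{C(\mathbb T^3)}=\sup_{\mathbb T^3}|f|^{-1}\in[0,\infty]$ is computed on the continuous representative of $f$ (with $1/0=\infty$). For $\mathbf U=(\varrho,\vartheta,\mathbf u)\in X^+$ write $S(\mathbf U)=\|\mathbf U\|_X+\|\varrho^{-1}\|_{C(\mathbb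 T^3)}+\|\vartheta^{-1}\|_{C(\mathbb T^3)}$, and let $G(\mathbf U)=(1+S(\mathbf U))^{-2}$ for $\mathbf U\in X^+$, $G(\mathbf U_\infty)=0$. Let $(e_{\mathbf k})_{\mathbf k\in\mathbb Z^5}$ be any orthonormal basis of $L^2(\mathbb T^3;\mathbb C^5)$ that consists of trigonometric polynomials (in particular, it may be a real one, i.e. an orthonormal basis of $L^2(\mathbb T^3;\mathbb R^5)$), and let $$F_{\mathbf k}(\mathbf U)=\int_{\mathbb T^3}\mathbf U\cdot e_{\mathbf k}\,dx,\qquad Q_{1,\mathbf k}=G,\qquad Q_{2,\mathbf k}=G\,F_{\mathbf k},$$ $$d(\mathbf U;\mathbf V)=\sum_{i=1,2,\ \mathbf k\in\mathbb Z^5}\exp(-|\mathbf k|)\,\frac{|Q_{i,\mathbf k}(\mathbf U)-Q_{i,\mathbf k}(\mathbf V)|}{1+|Q_{i,\mathbf k}(\mathbf U)-Q_{i,\mathbf k}(\mathbf V)|},$$ where $|\mathbf k|$ is the Euclidean length of $\mathbf k$. Let $\mathcal C$ be the class of functions $\mathcal F:X^+_\infty\to\mathbb R$ whose restriction to $X^+$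 is bounded and continuous (in the norm of $X$) and satisfies $\lim_{S(\mathbf U)\to\infty}\mathcal F|_{X^+}(\mathbf U)=\mathcal F(\mathbf U_\infty)$. Then: 1. The series defining $d$ converges, and $d$ is a metric on $X^+_\infty$. 2. $X^+_\infty$ with the topology induced by $d$ is a Polish space, i.e. it is separable and completely metrizable. 3. For $\mathbf U\in X^+$ and $\mathbf U_n\in X^+_\infty$: $d(\mathbf U_n;\mathbf U)\to0$ if and only if $\mathbf U_n\in X^+$ for all $n$ large enough and $\mathbf U_n\to\mathbf U$ in $X$. 4. For $\mathbf U_n\in X^+_\infty$: $d(\mathbf U_n;\mathbf U_\infty)\to0$ if and only if for every $M>0$ there is $n(M)$ such that for all $n\ge n(M)$ either $\mathbf U_n=\mathbf U_\infty$ or $S(\mathbf U_n)>M$. 5. $\mathcal C=BC(X^+_\infty)$, the space of bounded $d$-continuous real functions on $X^+_\infty$. -/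

import Mathlib

open MeasureTheory Filter Topology
open scoped ENNReal ContDiff

instance factZeroLtTwoReal : Fact ((0 : ℝ) < 2) := ⟨two_pos⟩

/-- The flat torus `(ℝ/2ℤ)³`, i.e. `[-1,1]³` with opposite faces identified. Its `volume` is
Lebesgue measure (total mass `8`). -/
abbrev T3 : Type := Fin 3 → AddCircle (2 : ℝ)

namespace T3

/-- The covering map `ℝ³ → 𝕋³`. -/
def proj (y : Fin 3 → ℝ) : T3 := fun j => (y j : AddCircle (2 : ℝ))

/-- A function on the torus is smooth when its periodic lift to `ℝ³` is `C^∞`. -/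
def Smooth (φ : T3 → ℝ) : Prop := ContDiff ℝ ∞ (φ ∘ proj)

/-- The partial derivative of a function on the torus in the `j`-th coordinate direction. -/
noncomputable def partialDeriv (j : Fin 3) (φ : T3 → ℝ) : T3 → ℝ :=
  fun x => deriv (fun t : ℝ => φ (x + Pi.single j (t : AddCircle (2 : ℝ)))) 0

/-- `D^α = ∂₀^α₀ ∂₁^α₁ ∂₂^α₂`. -/
noncomputable def multiDeriv (α : Fin 3 → ℕ) (φ : T3 → ℝ) : T3 → ℝ :=
  (partialDeriv 0)^[α 0] ((partialDeriv 1)^[α 1] ((partialDeriv 2)^[α 2] φ))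

theorem isOpenQuotientMap_proj : IsOpenQuotientMap proj :=
  IsOpenQuotientMap.piMap (fun _ : Fin 3 =>
    (QuotientAddGroup.isOpenQuotientMap_mk :
      IsOpenQuotientMap (fun a : ℝ => (a : AddCircle (2 : ℝ)))))

theorem Smooth.continuous {φ : T3 → ℝ} (h : Smooth φ) : Continuous φ :=
  isOpenQuotientMap_proj.isQuotientMap.continuous_iff.mpr (ContDiff.continuous h)

theorem Smooth.partialDeriv {φ : T3 → ℝ} (h : Smooth φ) (j : Fin 3) :
    Smooth (partialDeriv j φ) := by
  have key : T3.partialDeriv j φ ∘ proj =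
      fun y => fderiv ℝ (φ ∘ proj) y (Pi.single j (1 : ℝ)) := by
    funext y
    have hd : HasFDerivAt (φ ∘ proj) (fderiv ℝ (φ ∘ proj) y) (y + (0 : ℝ) • Pi.single j 1) := by
      simpa using ((ContDiff.differentiable h (by simp)) y).hasFDerivAt
    have hl : HasDerivAt (fun t : ℝ => y + t • (Pi.single j (1 : ℝ) : Fin 3 → ℝ))
        (Pi.single j (1 : ℝ)) 0 := by
      simpa using ((hasDerivAt_id (0 : ℝ)).smul_const
        (Pi.single j (1 : ℝ) : Fin 3 → ℝ)).const_add y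
    have hc := (hd.comp_hasDerivAt (0 : ℝ) hl).deriv
    rw [← hc]
    simp only [Function.comp_def, T3.partialDeriv]
    congr 1
    funext t
    congr 1
    funext i
    by_cases hi : i = j
    · subst hi; simp [proj]
    · simp [proj, hi]
  unfold Smooth
  rw [key]
  exact (ContDiff.fderiv_right (m := ∞) h (by simp)).clm_apply contDiff_const

theorem Smooth.iterate {φ : T3 → ℝ} (h : Smooth φ) (j : Fin 3) (n : ℕ) :
    Smooth ((T3.partialDeriv j)^[n] φ) := by
  induction n with
  | zero => exact h
  | succ n ih => rw [Function.iterate_succ_apply']; exact ih.partialDeriv j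

theorem Smooth.multiDeriv {φ : T3 → ℝ} (h : Smooth φ) (α : Fin 3 → ℕ) :
    Smooth (multiDeriv α φ) :=
  ((h.iterate 2 _).iterate 1 _).iterate 0 _

end T3

section Sobolev

/-- `w` is the weak derivative `D^α v` on the torus. -/
def IsWeakDeriv {E : Type*} [NormedAddCommGroup E] [NormedSpace ℝ E]
    (α : Fin 3 → ℕ) (v w : T3 → E) : Prop :=
  ∀ φ : T3 → ℝ, T3.Smooth φ →
    ∫ x, T3.multiDeriv α φ x • v x = (-1 : ℝ) ^ (∑ j, α j) • ∫ x, φ x • w x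

theorem integrable_smul_Lp {E : Type*} [NormedAddCommGroup E] [NormedSpace ℝ E]
    {p : ℝ≥0∞} [Fact (1 ≤ p)] {φ : T3 → ℝ} (hφ : Continuous φ)
    (v : Lp E p (volume : Measure T3)) : Integrable (fun x => φ x • v x) volume := by
  obtain ⟨C, hC⟩ := isCompact_univ.exists_bound_of_continuousOn (f := φ) hφ.continuousOn
  exact ((Lp.memLp v).integrable Fact.out).bdd_smul C hφ.aestronglyMeasurable
    (Eventually.of_forall fun x => hC x (Set.mem_univ x))

/-- Multi-indices `α ∈ ℕ³` with `|α| ≤ k`. -/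
abbrev MultiIdx (k : ℕ) : Type := {α : Fin 3 → Fin (k + 1) // ∑ j, (α j : ℕ) ≤ k}

/-- The multi-index `(0,0,0)`. -/
def MultiIdx.zero (k : ℕ) : MultiIdx k := ⟨0, by simp⟩

/-- The Sobolev space `W^{k,p}(𝕋³; E)`. An element is a function `v ∈ L^p` recorded together with
its (unique) weak derivatives `D^α v ∈ L^p`, `|α| ≤ k`; the norm that the ambient `ℓ^p` product of
`L^p` spaces induces is `(∑_{|α| ≤ k} ‖D^α v‖_{L^p}^p)^{1/p}`. -/
def Sobolev (k : ℕ) (p : ℝ≥0∞) [Fact (1 ≤ p)] (E : Type*) [NormedAddCommGroup E]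
    [NormedSpace ℝ E] :
    Submodule ℝ (PiLp p (fun _ : MultiIdx k => Lp E p (volume : Measure T3))) where
  carrier := {V | ∀ α : MultiIdx k,
    IsWeakDeriv (fun j => (α.1 j : ℕ)) (V (MultiIdx.zero k)) (V α)}
  zero_mem' := by
    intro α φ hφ
    have h0 : ((0 : Lp E p (volume : Measure T3)) : T3 → E) =ᵐ[volume] 0 := Lp.coeFn_zero _ _ _
    have h1 : ∀ ψ : T3 → ℝ,
        ∫ x, ψ x • ((0 : Lp E p (volume : Measure T3)) : T3 → E) x = 0 := by
      intro ψ
      refine integral_eq_zero_of_ae ?_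
      filter_upwards [h0] with x hx
      rw [hx, Pi.zero_apply, smul_zero]
    simp only [PiLp.zero_apply, h1, smul_zero]
  add_mem' := by
    intro V W hV hW α φ hφ
    have h1 : ∀ (ψ : T3 → ℝ), Continuous ψ → ∀ f g : Lp E p (volume : Measure T3),
        ∫ x, ψ x • ((f + g : Lp E p (volume : Measure T3)) : T3 → E) x =
          (∫ x, ψ x • f x) + ∫ x, ψ x • g x := by
      intro ψ hψ f g
      rw [← integral_add (integrable_smul_Lp hψ f) (integrable_smul_Lp hψ g)]
      refine integral_congr_ae ?_
      filter_upwards [Lp.coeFn_add f g] with x hx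
      rw [hx, Pi.add_apply, smul_add]
    simp only [PiLp.add_apply]
    rw [h1 _ (hφ.multiDeriv _).continuous, h1 _ hφ.continuous, hV α φ hφ, hW α φ hφ, smul_add]
  smul_mem' := by
    intro c V hV α φ hφ
    have h1 : ∀ (ψ : T3 → ℝ) (f : Lp E p (volume : Measure T3)),
        ∫ x, ψ x • ((c • f : Lp E p (volume : Measure T3)) : T3 → E) x =
          c • ∫ x, ψ x • f x := by
      intro ψ f
      rw [← integral_smul]
      refine integral_congr_ae ?_
      filter_upwards [Lp.coeFn_smul c f] with x hx
      rw [hx, Pi.smul_apply, smul_comm c]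
    simp only [PiLp.smul_apply]
    rw [h1, h1, hV α φ hφ, smul_comm c]

/-- The function underlying an element of `W^{k,p}`. -/
noncomputable def Sobolev.fn {k : ℕ} {p : ℝ≥0∞} [Fact (1 ≤ p)]
    {E : Type*} [NormedAddCommGroup E] [NormedSpace ℝ E] (v : Sobolev k p E) : T3 → E :=
  (v : PiLp p (fun _ : MultiIdx k => Lp E p (volume : Measure T3))) (MultiIdx.zero k)

end Sobolev

/-- `‖f⁻¹‖_{C(𝕋³)} = sup |f|⁻¹ ∈ [0,∞]`, computed on the continuous representative of `f`
(with `1/0 = ∞`; the value is `∞` if there is no continuous representative). -/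
noncomputable def invCNorm (f : T3 → ℝ) : ℝ≥0∞ :=
  ⨅ (w : C(T3, ℝ)) (_ : f =ᵐ[volume] w), ⨆ x, ‖w x‖ₑ⁻¹

/-- The phase space `X = W^{1,q}(𝕋³) × W^{2,2}(𝕋³) × W^{2,2}(𝕋³; ℝ³)` of triples `(ϱ, ϑ, u)`, with
the norm `‖(ϱ, ϑ, u)‖_X = ‖ϱ‖ + ‖ϑ‖ + ‖u‖`. -/
abbrev PhaseSpace (q : ℝ≥0∞) [Fact (1 ≤ q)] : Type :=
  WithLp 1 (Sobolev 1 q ℝ × WithLp 1 (Sobolev 2 2 ℝ × Sobolev 2 2 (EuclideanSpace ℝ (Fin 3))))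

namespace PhaseSpace

variable {q : ℝ≥0∞} [Fact (1 ≤ q)]

/-- The density `ϱ`. -/
noncomputable def density (U : PhaseSpace q) : T3 → ℝ := Sobolev.fn U.fst

/-- The temperature `ϑ`. -/
noncomputable def temperature (U : PhaseSpace q) : T3 → ℝ := Sobolev.fn U.snd.fst

/-- The velocity `u`. -/
noncomputable def velocity (U : PhaseSpace q) : T3 → EuclideanSpace ℝ (Fin 3) :=
  Sobolev.fn U.snd.snd

/-- The `ℝ⁵`-valued function `(ϱ, ϑ, u₁, u₂, u₃)`. -/
noncomputable def vec (U : PhaseSpace q) (x : T3) : Fin 5 → ℝ :=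
  ![U.density x, U.temperature x, U.velocity x 0, U.velocity x 1, U.velocity x 2]

/-- `‖U‖_X + ‖ϱ⁻¹‖_C + ‖ϑ⁻¹‖_C`; only used for `U ∈ X⁺`, where all three terms are finite. -/
noncomputable def size (U : PhaseSpace q) : ℝ :=
  ‖U‖ + (invCNorm U.density).toReal + (invCNorm U.temperature).toReal

end PhaseSpace

/-- `X⁺ = {(ϱ, ϑ, u) ∈ X : ‖ϱ⁻¹‖_C < ∞, ‖ϑ⁻¹‖_C < ∞}`. -/
def XPlus (q : ℝ≥0∞) [Fact (1 ≤ q)] : Set (PhaseSpace q) :=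
  {U | invCNorm U.density < ⊤ ∧ invCNorm U.temperature < ⊤}

/-- `X⁺_∞ = X⁺ ∪ {(0,0,0)}`, as a bare type: it carries no topology of its own. -/
def XPlusInf (q : ℝ≥0∞) [Fact (1 ≤ q)] : Type :=
  {U : PhaseSpace q // U ∈ XPlus q ∪ {0}}

namespace XPlusInf

variable {q : ℝ≥0∞} [Fact (1 ≤ q)]

/-- The underlying element of `X`. -/
noncomputable def toX (U : XPlusInf q) : PhaseSpace q := U.1

/-- The inclusion `X⁺ ⊆ X⁺_∞`. -/
noncomputable def ofPlus (U : XPlus q) : XPlusInf q := ⟨U.1, Or.inl U.2⟩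

/-- The point `U_∞ = (0,0,0)`. -/
noncomputable def infty (q : ℝ≥0∞) [Fact (1 ≤ q)] : XPlusInf q := ⟨0, Or.inr rfl⟩

open Classical in
/-- The weight `G`. -/
noncomputable def weight (U : XPlusInf q) : ℝ :=
  if U.toX ∈ XPlus q then ((1 + U.toX.size) ^ 2)⁻¹ else 0

/-- The class `𝒞`: functions that are bounded and continuous on `X⁺` (with the topology of `X`) and
tend to their value at `(0,0,0)` as `‖U‖_X + ‖ϱ⁻¹‖_C + ‖ϑ⁻¹‖_C → ∞`, `U ∈ X⁺`. -/
def classC (q : ℝ≥0∞) [Fact (1 ≤ q)] : Set (XPlusInf q → ℝ) :=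
  {F | Continuous (fun U : XPlus q => F (ofPlus U)) ∧
    (∃ C : ℝ, ∀ U : XPlus q, |F (ofPlus U)| ≤ C) ∧
    Tendsto (fun U : XPlus q => F (ofPlus U))
      (comap (fun U : XPlus q => (U : PhaseSpace q).size) atTop) (𝓝 (F (infty q)))}

end XPlusInf

/-- `L²(𝕋³; ℂ⁵)`. -/
abbrev L2C5 : Type := Lp (EuclideanSpace ℂ (Fin 5)) 2 (volume : Measure T3)

/-- `f` is a (vector-valued) trigonometric polynomial
`x ↦ ∑_{n ∈ s} exp(iπ n·x) c_n`, `s ⊆ ℤ³` finite, `c_n ∈ ℂ⁵`. -/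
def IsTrigPoly (f : T3 → EuclideanSpace ℂ (Fin 5)) : Prop :=
  ∃ (s : Finset (Fin 3 → ℤ)) (c : (Fin 3 → ℤ) → EuclideanSpace ℂ (Fin 5)),
    f =ᵐ[volume] fun x => ∑ n ∈ s, (∏ j, fourier (n j) (x j)) • c n

section Distance

variable {q : ℝ≥0∞} [Fact (1 ≤ q)] (e : HilbertBasis (Fin 5 → ℤ) ℂ L2C5)

/-- The Fourier coefficient `F_k(U) = ∫ U · e_k dx`. -/
noncomputable def fourierF (k : Fin 5 → ℤ) (U : PhaseSpace q) : ℂ :=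
  ∫ x, ∑ j, (U.vec x j : ℂ) * (e k : T3 → EuclideanSpace ℂ (Fin 5)) x j

/-- `Q_{1,k} = G` and `Q_{2,k} = G F_k`; the indices `1, 2` are `0, 1 : Fin 2`. -/
noncomputable def fourierQ (i : Fin 2) (k : Fin 5 → ℤ) (U : XPlusInf q) : ℂ :=
  if i = 0 then (U.weight : ℂ) else (U.weight : ℂ) * fourierF e k U.toX

/-- The summand of index `(i, k)` of `d(U; V)`; `|k|` is the Euclidean length. -/
noncomputable def phaseTerm (U V : XPlusInf q) (ik : Fin 2 × (Fin 5 → ℤ)) : ℝ :=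
  Real.exp (-Real.sqrt (∑ j, (ik.2 j : ℝ) ^ 2)) *
    (‖fourierQ e ik.1 ik.2 U - fourierQ e ik.1 ik.2 V‖ /
      (1 + ‖fourierQ e ik.1 ik.2 U - fourierQ e ik.1 ik.2 V‖))

/-- `d(U; V)`. -/
noncomputable def phaseDist (U V : XPlusInf q) : ℝ := ∑' ik, phaseTerm e U V ik

end Distance

/-! Convergence in `d` is convergence of every coordinate `Q_{i,k}`, because each term of the series
is dominated by the summable `exp(-|k|)`. So everything reduces to reading off what convergence of
`G` and of all `G F_k` means.

Near a point `U` of `X⁺` the limit of `G` is positive, hence `S(U_n) → S(U)` and `F_k(U_n) → F_k(U)`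
for all `k`. Boundedness in `X` and completeness of the basis turn the latter into weak `L²`
convergence of the three components. `S` is a sum of five terms (three norms, two sup norms of
reciprocals), each sequentially lower semicontinuous along such sequences. As the sums converge, no
term can gain, so each one converges. Weak convergence plus convergence of the norm gives strong
convergence by Clarkson's inequality, valid since the exponents `q` and `2` are finite and at least
`2` (`Sobolev.tendsto_of_weakConv`).

Conversely, strong convergence within `X⁺` makes the continuous representatives converge uniformly
by Morrey's inequality (`3/q < 1` and `3/2 < 2`), so `S`, `G` and all `Q_{i,k}` converge. Finiteness
of `‖f⁻¹‖_C` already supplies the representative, so Morrey is needed only as an a priori bound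
(`Sobolev.exists_abs_le`). It is proved by summing differences of dyadic mollifications, each an
integration by parts of order `k`.

At `U_∞` the exponent `-2` in `G` decides: `G ‖U‖ ≤ √G`, so `G → 0` alone forces `G F_k → 0`. The
map `U ↦ (G(U) U, G(U))` is a closed embedding into the separable Banach space `X × ℝ`, which gives
the Polish property. The description of `𝒞` then follows from the two characterizations of
convergence. -/

/-! ### Bump functions and product kernels on the torus. -/

/-- A smooth function on the line that vanishes outside `[-r, r]`. -/
structure IsBump (r : ℝ) (f : ℝ → ℝ) : Prop where
  contDiff : ContDiff ℝ ∞ f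
  abs_le : ∀ t, f t ≠ 0 → |t| ≤ r

theorem deriv_eq_zero_of_forall_abs_lt {f : ℝ → ℝ} {r t : ℝ} (h : ∀ t, f t ≠ 0 → |t| ≤ r)
    (ht : r < |t|) : deriv f t = 0 := by
  have : f =ᶠ[𝓝 t] fun _ => 0 := by
    filter_upwards [(isOpen_lt continuous_const continuous_abs).mem_nhds ht] with s hs
    by_contra h0
    exact absurd (h s h0) (not_le.mpr hs)
  rw [this.deriv_eq, deriv_const]

theorem IsBump.deriv {r : ℝ} {f : ℝ → ℝ} (h : IsBump r f) : IsBump r (deriv f) :=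
  ⟨((contDiff_infty_iff_deriv (𝕜 := ℝ)).mp h.contDiff).2, fun t ht => by
    by_contra hc
    exact ht (deriv_eq_zero_of_forall_abs_lt h.abs_le (not_le.mp hc))⟩

theorem IsBump.iteratedDeriv {r : ℝ} {f : ℝ → ℝ} (h : IsBump r f) (n : ℕ) :
    IsBump r (iteratedDeriv n f) := by
  induction n with
  | zero => simpa using h
  | succ n ih => rw [iteratedDeriv_succ]; exact ih.deriv

theorem IsBump.mono {r s : ℝ} {f : ℝ → ℝ} (h : IsBump r f) (hrs : r ≤ s) : IsBump s f :=
  ⟨h.contDiff, fun t ht => (h.abs_le t ht).trans hrs⟩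

theorem IsBump.exists_bound {r : ℝ} {f : ℝ → ℝ} (h : IsBump r f) : ∃ C, 0 ≤ C ∧ ∀ t, |f t| ≤ C := by
  obtain ⟨C, hC⟩ := (isCompact_Icc (a := -r) (b := r)).exists_bound_of_continuousOn
    h.contDiff.continuous.continuousOn
  refine ⟨max C 0, le_max_right _ _, fun t => ?_⟩
  by_cases ht : f t = 0
  · simp [ht]
  · exact (hC t (_root_.abs_le.mp (h.abs_le t ht))).trans (le_max_left _ _)

theorem IsBump.scale {r : ℝ} {f : ℝ → ℝ} (h : IsBump r f) (c : ℝ) {a : ℝ} (ha : 0 < a) :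
    IsBump (r / a) (fun t => c * f (a * t)) := by
  refine ⟨contDiff_const.mul (h.contDiff.comp (contDiff_const.mul contDiff_id)), fun t ht => ?_⟩
  have := h.abs_le (a * t) (right_ne_zero_of_mul ht)
  rw [abs_mul, abs_of_pos ha] at this
  rwa [le_div_iff₀ ha, mul_comm]

/-- The function on the circle of length `2` that agrees with `f` on `(-1, 1]`. -/
noncomputable def circ (f : ℝ → ℝ) : AddCircle (2 : ℝ) → ℝ := AddCircle.liftIoc 2 (-1) f

theorem circ_coe_of_mem {f : ℝ → ℝ} {t : ℝ} (ht : t ∈ Set.Ioc (-1 : ℝ) 1) :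
    circ f (t : AddCircle (2 : ℝ)) = f t :=
  AddCircle.liftIoc_coe_apply (by convert! ht; norm_num)

theorem exists_coe_eq (y : AddCircle (2 : ℝ)) :
    ∃ t ∈ Set.Ioc (-1 : ℝ) 1, (t : AddCircle (2 : ℝ)) = y := by
  have : y ∈ (fun t : ℝ => (t : AddCircle (2 : ℝ))) '' Set.Ioc (-1 : ℝ) (-1 + 2) := by
    rw [AddCircle.coe_image_Ioc_eq]; trivial
  obtain ⟨t, ht, h⟩ := this
  exact ⟨t, by convert! ht; norm_num, h⟩

/-- The range `|t| < 3/2` is where the translates of `[-1/2, 1/2]` by `±2` are not yet reached. It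
contains a neighbourhood of `[-1, 1]`, so the seam at `±1` is invisible to derivatives. -/
theorem circ_coe {f : ℝ → ℝ} (hf : IsBump (1 / 2) f) {t : ℝ} (ht : |t| < 3 / 2) :
    circ f (t : AddCircle (2 : ℝ)) = f t := by
  have h0 : ∀ s : ℝ, 1 / 2 < |s| → f s = 0 := fun s hs => by
    by_contra hc
    exact absurd (hf.abs_le s hc) (not_le.mpr hs)
  rw [abs_lt] at ht
  rcases le_or_gt t (-1) with h1 | h1
  · have : ((t : ℝ) : AddCircle (2 : ℝ)) = ((t + 2 : ℝ) : AddCircle (2 : ℝ)) := by simp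
    rw [this, circ_coe_of_mem ⟨by linarith, by linarith⟩, h0 t (by rw [lt_abs]; right; linarith),
      h0 _ (by rw [lt_abs]; left; linarith)]
  rcases le_or_gt t 1 with h2 | h2
  · exact circ_coe_of_mem ⟨h1, h2⟩
  · have : ((t : ℝ) : AddCircle (2 : ℝ)) = ((t - 2 : ℝ) : AddCircle (2 : ℝ)) := by
      rw [AddCircle.coe_sub, AddCircle.coe_period, sub_zero]
    rw [this, circ_coe_of_mem ⟨by linarith, by linarith⟩, h0 t (by rw [lt_abs]; left; linarith),
      h0 _ (by rw [lt_abs]; right; linarith)]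

theorem circ_add_eventuallyEq {f : ℝ → ℝ} (hf : IsBump (1 / 2) f) {s : ℝ}
    (hs : s ∈ Set.Ioc (-1 : ℝ) 1) :
    (fun t : ℝ => circ f ((s : AddCircle (2 : ℝ)) + t)) =ᶠ[𝓝 0] fun t => f (s + t) := by
  have : ∀ᶠ t : ℝ in 𝓝 0, |s + t| < 3 / 2 := by
    refine (isOpen_lt (by fun_prop) continuous_const).mem_nhds ?_
    simp only [Set.mem_ofPred_eq, add_zero, abs_lt]
    constructor <;> linarith [hs.1, hs.2]
  filter_upwards [this] with t ht
  rw [← AddCircle.coe_add, circ_coe hf ht]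

theorem contDiff_circ {f : ℝ → ℝ} (hf : IsBump (1 / 2) f) (y : AddCircle (2 : ℝ)) :
    ContDiff ℝ ∞ (fun t : ℝ => circ f (y + t)) := by
  rw [contDiff_iff_contDiffAt]
  intro t₁
  obtain ⟨s, hs, h⟩ := exists_coe_eq (y + t₁)
  have h1 : ContDiffAt ℝ ∞ (fun t : ℝ => circ f ((s : AddCircle (2 : ℝ)) + t)) 0 :=
    ContDiffAt.congr_of_eventuallyEq
      (hf.contDiff.comp (contDiff_const.add contDiff_id)).contDiffAt
      (circ_add_eventuallyEq hf hs)
  have h2 : (fun t : ℝ => circ f (y + t)) =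
      (fun t : ℝ => circ f ((s : AddCircle (2 : ℝ)) + t)) ∘ fun t => t - t₁ := by
    funext t
    simp only [Function.comp_apply, h, AddCircle.coe_sub]
    congr 1
    abel
  rw [h2]
  exact ContDiffAt.comp t₁ (by simpa using h1) (contDiffAt_id.sub contDiffAt_const)

theorem deriv_circ {f : ℝ → ℝ} (hf : IsBump (1 / 2) f) (y : AddCircle (2 : ℝ)) :
    deriv (fun t : ℝ => circ f (y + t)) 0 = circ (deriv f) y := by
  obtain ⟨s, hs, rfl⟩ := exists_coe_eq y
  rw [(circ_add_eventuallyEq hf hs).deriv_eq, deriv_comp_const_add, add_zero, circ_coe_of_mem hs]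

theorem norm_le_of_circ_ne_zero {f : ℝ → ℝ} {r : ℝ} (hf : IsBump r f) {y : AddCircle (2 : ℝ)}
    (hy : circ f y ≠ 0) : ‖y‖ ≤ r := by
  obtain ⟨s, hs, rfl⟩ := exists_coe_eq y
  rw [circ_coe_of_mem hs] at hy
  refine le_trans ?_ (hf.abs_le s hy)
  rw [← Real.norm_eq_abs]
  exact QuotientAddGroup.norm_mk_le_norm

theorem abs_circ_le {f : ℝ → ℝ} {C : ℝ} (hf : ∀ t, |f t| ≤ C) (y : AddCircle (2 : ℝ)) :
    |circ f y| ≤ C := by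
  obtain ⟨s, hs, rfl⟩ := exists_coe_eq y
  rw [circ_coe_of_mem hs]
  exact hf s

theorem circ_add (f g : ℝ → ℝ) (y : AddCircle (2 : ℝ)) :
    circ (fun t => f t + g t) y = circ f y + circ g y := by
  obtain ⟨s, hs, rfl⟩ := exists_coe_eq y
  simp only [circ_coe_of_mem hs]

/-- The product kernel `y ↦ ∏ j, f_j (y_j - x_j)` on the torus. -/
noncomputable def torusKernel (x : T3) (f : Fin 3 → ℝ → ℝ) (y : T3) : ℝ :=
  ∏ j, circ (f j) (y j - x j)

theorem smooth_torusKernel (x : T3) {f : Fin 3 → ℝ → ℝ} (hf : ∀ j, IsBump (1 / 2) (f j)) :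
    T3.Smooth (torusKernel x f) := by
  have : torusKernel x f ∘ T3.proj = fun z => ∏ j, circ (f j) (-x j + (z j : ℝ)) := by
    funext z
    simp only [Function.comp_apply, torusKernel, T3.proj]
    refine Finset.prod_congr rfl fun j _ => ?_
    congr 1
    abel
  unfold T3.Smooth
  rw [this]
  exact contDiff_prod fun j _ => (contDiff_circ (hf j) (-x j)).comp (contDiff_apply ℝ ℝ j)

theorem partialDeriv_torusKernel (x : T3) {f : Fin 3 → ℝ → ℝ} (j : Fin 3)
    (hf : IsBump (1 / 2) (f j)) :
    T3.partialDeriv j (torusKernel x f) = torusKernel x (Function.update f j (deriv (f j))) := by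
  funext y
  have h1 : ∀ t : ℝ, torusKernel x f (y + Pi.single j (t : AddCircle (2 : ℝ))) =
      circ (f j) (y j - x j + t) * ∏ i ∈ Finset.univ.erase j, circ (f i) (y i - x i) := by
    intro t
    rw [torusKernel, ← Finset.mul_prod_erase _ _ (Finset.mem_univ j)]
    congr 1
    · congr 1
      simp only [Pi.add_apply, Pi.single_eq_same]
      abel
    · refine Finset.prod_congr rfl fun i hi => ?_
      simp [Finset.ne_of_mem_erase hi]
  have hd : DifferentiableAt ℝ (fun t : ℝ => circ (f j) (y j - x j + t)) 0 :=
    (contDiff_circ hf _).differentiable (by simp) _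
  simp only [T3.partialDeriv, h1]
  rw [deriv_mul_const hd, deriv_circ hf, torusKernel,
    ← Finset.mul_prod_erase _ _ (Finset.mem_univ j), Function.update_self]
  congr 1
  refine Finset.prod_congr rfl fun i hi => ?_
  rw [Function.update_of_ne (Finset.ne_of_mem_erase hi)]

theorem iterate_partialDeriv_torusKernel (x : T3) (j : Fin 3) (n : ℕ) {f : Fin 3 → ℝ → ℝ}
    (hf : IsBump (1 / 2) (f j)) :
    (T3.partialDeriv j)^[n] (torusKernel x f) =
      torusKernel x (Function.update f j (iteratedDeriv n (f j))) := by
  induction n with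
  | zero => simp
  | succ n ih =>
    rw [Function.iterate_succ_apply', ih, partialDeriv_torusKernel]
    · rw [Function.update_idem, Function.update_self, iteratedDeriv_succ]
    · rw [Function.update_self]
      exact hf.iteratedDeriv n

theorem multiDeriv_single (j : Fin 3) (n : ℕ) (φ : T3 → ℝ) :
    T3.multiDeriv (fun i => if i = j then n else 0) φ = (T3.partialDeriv j)^[n] φ := by
  fin_cases j <;> simp [T3.multiDeriv]

theorem abs_torusKernel_le (x : T3) {f : Fin 3 → ℝ → ℝ} {C : Fin 3 → ℝ}
    (hf : ∀ j t, |f j t| ≤ C j) (y : T3) : |torusKernel x f y| ≤ ∏ j, C j := by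
  rw [torusKernel, Finset.abs_prod]
  exact Finset.prod_le_prod (fun _ _ => abs_nonneg _) fun j _ => abs_circ_le (hf j) _

theorem mem_closedBall_of_torusKernel_ne_zero {x : T3} {f : Fin 3 → ℝ → ℝ} {r : ℝ}
    (hf : ∀ j, IsBump r (f j)) {y : T3} (hy : torusKernel x f y ≠ 0) :
    y ∈ Metric.closedBall x r := by
  have h : ∀ j, ‖y j - x j‖ ≤ r := fun j =>
    norm_le_of_circ_ne_zero (hf j) (Finset.prod_ne_zero_iff.mp hy j (Finset.mem_univ j))
  rw [Metric.mem_closedBall, dist_eq_norm, pi_norm_le_iff_of_nonneg ((norm_nonneg _).trans (h 0))]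
  exact h

theorem volume_closedBall_le (x : T3) {r : ℝ} (hr : 0 ≤ r) :
    volume (Metric.closedBall x r) ≤ ENNReal.ofReal ((2 * r) ^ 3) := by
  rw [closedBall_pi _ hr, volume_pi_pi]
  simp only [AddCircle.volume_closedBall]
  rw [Finset.prod_const, Finset.card_univ, Fintype.card_fin, ENNReal.ofReal_pow (by positivity)]
  gcongr
  exact min_le_right _ _

theorem integral_torusKernel (x : T3) {f : Fin 3 → ℝ → ℝ} :
    ∫ y, torusKernel x f y = ∏ j, ∫ t in (-1 : ℝ)..1, f j t := by
  simp only [torusKernel]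
  rw [integral_fintype_prod_volume_eq_prod (fun j (t : AddCircle (2 : ℝ)) => circ (f j) (t - x j))]
  refine Finset.prod_congr rfl fun j _ => ?_
  rw [integral_sub_right_eq_self (fun t => circ (f j) t), circ,
    AddCircle.integral_liftIoc_eq_intervalIntegral]
  norm_num

/-! ### Dyadic mollifiers and their differences as derivatives of bumps. -/

/-- A smooth function that is `0` on `(-∞, -1/2]` and the identity on `[0, ∞)`. -/
noncomputable def ramp (t : ℝ) : ℝ := t * Real.smoothTransition (2 * t + 1)

theorem contDiff_ramp : ContDiff ℝ ∞ ramp :=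
  contDiff_id.mul (Real.smoothTransition.contDiff.comp
    ((contDiff_const.mul contDiff_id).add contDiff_const))

theorem ramp_of_le {t : ℝ} (ht : t ≤ -1 / 2) : ramp t = 0 := by
  rw [ramp, Real.smoothTransition.zero_of_nonpos (by linarith), mul_zero]

theorem ramp_of_nonneg {t : ℝ} (ht : 0 ≤ t) : ramp t = t := by
  rw [ramp, Real.smoothTransition.one_of_one_le (by linarith), mul_one]

theorem deriv_ramp_of_lt {t : ℝ} (ht : t < -1 / 2) : deriv ramp t = 0 := by
  have : ramp =ᶠ[𝓝 t] fun _ => 0 := by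
    filter_upwards [Iio_mem_nhds ht] with s hs using ramp_of_le (le_of_lt hs)
  rw [this.deriv_eq, deriv_const]

theorem deriv_ramp_of_pos {t : ℝ} (ht : 0 < t) : deriv ramp t = 1 := by
  have : ramp =ᶠ[𝓝 t] fun s => s := by
    filter_upwards [Ioi_mem_nhds ht] with s hs using ramp_of_nonneg (le_of_lt hs)
  rw [this.deriv_eq, deriv_id'']

/-- The mollifier: a smooth function of integral one supported in `[-1/2, 0]`. -/
noncomputable def mollifier : ℝ → ℝ := iteratedDeriv 2 ramp

theorem mollifier_eq : mollifier = deriv (deriv ramp) := by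
  rw [mollifier, iteratedDeriv_succ, iteratedDeriv_one]

theorem contDiff_deriv_ramp : ContDiff ℝ ∞ (deriv ramp) :=
  ((contDiff_infty_iff_deriv (𝕜 := ℝ)).mp contDiff_ramp).2

theorem isBump_mollifier : IsBump (1 / 2) mollifier := by
  rw [mollifier_eq]
  refine ⟨((contDiff_infty_iff_deriv (𝕜 := ℝ)).mp contDiff_deriv_ramp).2, fun t ht => ?_⟩
  by_contra hc
  refine ht ?_
  rcases lt_abs.mp (not_le.mp hc) with h | h
  · have : deriv ramp =ᶠ[𝓝 t] fun _ => 1 := by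
      filter_upwards [Ioi_mem_nhds (show (0 : ℝ) < t by linarith)] with s hs
        using deriv_ramp_of_pos hs
    rw [this.deriv_eq, deriv_const]
  · have : deriv ramp =ᶠ[𝓝 t] fun _ => 0 := by
      filter_upwards [Iio_mem_nhds (show t < -1 / 2 by linarith)] with s hs
        using deriv_ramp_of_lt hs
    rw [this.deriv_eq, deriv_const]

/-- The rescaled mollifier. -/
noncomputable def mollifierAt (m : ℕ) (t : ℝ) : ℝ := 2 ^ m * mollifier (2 ^ m * t)

theorem isBump_mollifierAt (m : ℕ) : IsBump (1 / 2 / 2 ^ m) (mollifierAt m) :=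
  isBump_mollifier.scale _ (by positivity)

/-- The antiderivative `deriv ramp (2 ^ m * t)` climbs from `0` at `t = -1` to `1` at `t = 1`. -/
theorem integral_mollifierAt (m : ℕ) : ∫ t in (-1 : ℝ)..1, mollifierAt m t = 1 := by
  have hd : ∀ t, HasDerivAt (fun t : ℝ => deriv ramp (2 ^ m * t)) (mollifierAt m t) t := by
    intro t
    have h1 : HasDerivAt (deriv ramp) (mollifier (2 ^ m * t)) (2 ^ m * t) := by
      rw [mollifier_eq]
      exact (contDiff_deriv_ramp.differentiable (by simp) _).hasDerivAt
    have h2 : HasDerivAt (fun t : ℝ => 2 ^ m * t) (2 ^ m : ℝ) t := by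
      simpa using (hasDerivAt_id t).const_mul (2 ^ m : ℝ)
    have := h1.comp t h2
    rwa [mul_comm] at this
  rw [intervalIntegral.integral_eq_sub_of_hasDerivAt (fun t _ => hd t)
    ((isBump_mollifierAt m).contDiff.continuous.intervalIntegrable _ _)]
  have : (1 : ℝ) ≤ 2 ^ m := one_le_pow₀ one_le_two
  rw [deriv_ramp_of_pos (by linarith), deriv_ramp_of_lt (by linarith), sub_zero]

/-- A bump function whose second derivative is `2 κ(2·) - κ`, `κ` the mollifier. -/
noncomputable def rampDiff (t : ℝ) : ℝ := 2⁻¹ * ramp (2 * t) - ramp t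

theorem isBump_rampDiff : IsBump (1 / 2) rampDiff := by
  refine ⟨(contDiff_const.mul (contDiff_ramp.comp (contDiff_const.mul contDiff_id))).sub
    contDiff_ramp, fun t ht => ?_⟩
  by_contra hc
  refine ht ?_
  rcases lt_abs.mp (not_le.mp hc) with h | h
  · rw [rampDiff, ramp_of_nonneg (by linarith), ramp_of_nonneg (by linarith)]
    ring
  · rw [rampDiff, ramp_of_le (by linarith), ramp_of_le (by linarith)]
    ring

theorem iteratedDeriv_two_rampDiff (t : ℝ) :
    iteratedDeriv 2 rampDiff t = 2 * mollifier (2 * t) - mollifier t := by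
  have h0 : ContDiff ℝ 2 ramp := contDiff_infty.mp contDiff_ramp 2
  have h1 : ContDiff ℝ 2 (fun t : ℝ => ramp (2 * t)) := h0.comp (contDiff_const.mul contDiff_id)
  have h2 : rampDiff = (fun t => 2⁻¹ * ramp (2 * t)) - ramp := rfl
  rw [h2, iteratedDeriv_sub (contDiff_const.mul h1).contDiffAt h0.contDiffAt,
    iteratedDeriv_const_mul_field, iteratedDeriv_comp_const_mul h0, mollifier]
  ring

/-- A bump function whose `k`-th derivative (`k ≤ 2`) is the difference of two consecutive
mollifiers. -/
noncomputable def mollifierDiff (k m : ℕ) (t : ℝ) : ℝ :=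
  2 ^ m / (2 ^ m) ^ k * iteratedDeriv (2 - k) rampDiff (2 ^ m * t)

theorem isBump_mollifierDiff (k m : ℕ) : IsBump (1 / 2 / 2 ^ m) (mollifierDiff k m) :=
  (isBump_rampDiff.iteratedDeriv _).scale _ (by positivity)

/-- The divisor `(2 ^ m) ^ k` absorbs the chain rule. The single function `rampDiff` serves every
order `k ≤ 2`, because a derivative of a bump is again a bump. -/
theorem iteratedDeriv_mollifierDiff {k : ℕ} (hk : k ≤ 2) (m : ℕ) (t : ℝ) :
    iteratedDeriv k (mollifierDiff k m) t = mollifierAt (m + 1) t - mollifierAt m t := by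
  have h0 : ContDiff ℝ k (iteratedDeriv (2 - k) rampDiff) :=
    contDiff_infty.mp (isBump_rampDiff.iteratedDeriv _).contDiff k
  have h1 : iteratedDeriv k (iteratedDeriv (2 - k) rampDiff) = iteratedDeriv 2 rampDiff := by
    simp only [iteratedDeriv_eq_iterate]
    rw [← Function.iterate_add_apply, Nat.add_sub_cancel' hk]
  have h2 : mollifierDiff k m = fun t =>
    2 ^ m / (2 ^ m) ^ k * iteratedDeriv (2 - k) rampDiff (2 ^ m * t) := rfl
  rw [h2, iteratedDeriv_const_mul_field, iteratedDeriv_comp_const_mul h0, h1]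
  simp only [iteratedDeriv_two_rampDiff, mollifierAt, pow_succ]
  field_simp

/-! ### Morrey's inequality. -/

/-- Hölder's inequality on the cube of side `2r` that carries the kernel. -/
theorem abs_integral_torusKernel_mul_le {p : ℝ≥0∞} [Fact (1 ≤ p)] (x : T3) {f : Fin 3 → ℝ → ℝ}
    {C : Fin 3 → ℝ} (hC : ∀ j t, |f j t| ≤ C j) {r : ℝ} (hr : 0 ≤ r)
    (hf : ∀ j, IsBump r (f j)) (v : Lp ℝ p (volume : Measure T3)) :
    |∫ y, torusKernel x f y * v y| ≤
      (∏ j, C j) * (((2 * r) ^ 3) ^ (1 - 1 / p.toReal) * ‖v‖) := by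
  have hC0 : 0 ≤ ∏ j, C j := Finset.prod_nonneg fun j _ => (abs_nonneg _).trans (hC j 0)
  set S := Metric.closedBall x r
  have hp1 : (1 : ℝ≥0∞) ≤ p := Fact.out
  have hpr : 0 ≤ 1 - 1 / p.toReal := by
    rcases eq_or_ne p ⊤ with rfl | hp
    · simp
    · have : 1 ≤ p.toReal := by simpa using ENNReal.toReal_mono hp hp1
      rw [sub_nonneg, div_le_one (by linarith)]
      exact this
  have hint : Integrable v volume := (Lp.memLp v).integrable hp1
  have h1 : |∫ y, torusKernel x f y * v y| ≤ ∫ y in S, (∏ j, C j) * ‖v y‖ := by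
    rw [← Real.norm_eq_abs, ← setIntegral_eq_integral_of_forall_compl_eq_zero (s := S)]
    · refine norm_integral_le_of_norm_le (hint.norm.const_mul _).integrableOn ?_
      refine Eventually.of_forall fun y => ?_
      rw [norm_mul, Real.norm_eq_abs]
      gcongr
      exact abs_torusKernel_le x hC y
    · intro y hy
      by_contra hc
      exact hy (mem_closedBall_of_torusKernel_ne_zero hf (left_ne_zero_of_mul hc))
  refine h1.trans ?_
  rw [integral_const_mul]
  gcongr
  have h2 : ∫ y in S, ‖v y‖ = (eLpNorm v 1 (volume.restrict S)).toReal := by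
    rw [integral_norm_eq_lintegral_enorm hint.aestronglyMeasurable.restrict,
      eLpNorm_one_eq_lintegral_enorm]
  rw [h2]
  have h3 : eLpNorm v 1 (volume.restrict S) ≤
      eLpNorm v p volume * ENNReal.ofReal (((2 * r) ^ 3) ^ (1 - 1 / p.toReal)) := by
    refine (eLpNorm_le_eLpNorm_mul_rpow_measure_univ hp1
      hint.aestronglyMeasurable.restrict).trans ?_
    rw [Measure.restrict_apply_univ, ENNReal.toReal_one, div_one,
      ← ENNReal.ofReal_rpow_of_nonneg (by positivity) hpr]
    gcongr
    · exact Measure.restrict_le_self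
    · exact volume_closedBall_le x hr
  refine (ENNReal.toReal_mono (ENNReal.mul_ne_top (Lp.memLp v).2.ne ENNReal.ofReal_ne_top)
    h3).trans (le_of_eq ?_)
  rw [ENNReal.toReal_mul, ENNReal.toReal_ofReal (by positivity), ← Lp.norm_def, mul_comm]

/-- The multi-index `k e_j`. -/
def MultiIdx.single (k : ℕ) (j : Fin 3) : MultiIdx k :=
  ⟨fun i => if i = j then Fin.last k else 0, by
    simp [apply_ite (fun n : Fin (k + 1) => (n : ℕ))]⟩

theorem Sobolev.norm_apply_le {k : ℕ} {p : ℝ≥0∞} [Fact (1 ≤ p)] {E : Type*}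
    [NormedAddCommGroup E] [NormedSpace ℝ E] (v : Sobolev k p E) (α : MultiIdx k) :
    ‖v.1 α‖ ≤ ‖v‖ :=
  PiLp.norm_apply_le v.1 α

/-- Integration by parts of order `k` in one coordinate direction. Only the pure derivatives `∂_j^k
v` enter the Morrey argument. -/
theorem Sobolev.integral_torusKernel_update {k : ℕ} {p : ℝ≥0∞} [Fact (1 ≤ p)]
    (v : Sobolev k p ℝ) (x : T3) {f : Fin 3 → ℝ → ℝ} (hf : ∀ j, IsBump (1 / 2) (f j))
    (j : Fin 3) :
    ∫ y, torusKernel x (Function.update f j (iteratedDeriv k (f j))) y * Sobolev.fn v y =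
      (-1) ^ k * ∫ y, torusKernel x f y * v.1 (MultiIdx.single k j) y := by
  have h := v.2 (MultiIdx.single k j) _ (smooth_torusKernel x hf)
  have h1 : (fun i => ((MultiIdx.single k j).1 i : ℕ)) = fun i => if i = j then k else 0 := by
    funext i
    simp [MultiIdx.single, apply_ite (fun n : Fin (k + 1) => (n : ℕ))]
  have h2 : ∑ i, ((MultiIdx.single k j).1 i : ℕ) = k := by
    rw [show ∑ i, ((MultiIdx.single k j).1 i : ℕ) = ∑ i, (if i = j then k else 0) from
      Finset.sum_congr rfl fun i _ => congrFun h1 i]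
    simp
  rw [h2, h1, multiDeriv_single, iterate_partialDeriv_torusKernel x j k (hf j)] at h
  simpa only [smul_eq_mul, Sobolev.fn] using h

theorem Sobolev.abs_integral_torusKernel_update_le {k : ℕ} {p : ℝ≥0∞} [Fact (1 ≤ p)]
    (v : Sobolev k p ℝ) (x : T3) {f : Fin 3 → ℝ → ℝ} {C : Fin 3 → ℝ}
    (hC : ∀ j t, |f j t| ≤ C j) {r : ℝ} (hr : 0 ≤ r) (hr' : r ≤ 1 / 2)
    (hf : ∀ j, IsBump r (f j)) (j : Fin 3) :
    |∫ y, torusKernel x (Function.update f j (iteratedDeriv k (f j))) y * Sobolev.fn v y| ≤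
      (∏ j, C j) * (((2 * r) ^ 3) ^ (1 - 1 / p.toReal) * ‖v‖) := by
  have hC0 : 0 ≤ ∏ j, C j := Finset.prod_nonneg fun j _ => (abs_nonneg _).trans (hC j 0)
  rw [Sobolev.integral_torusKernel_update v x (fun j => (hf j).mono hr') j, abs_mul, abs_pow,
    abs_neg,
    abs_one, one_pow, one_mul]
  refine (abs_integral_torusKernel_mul_le x hC hr hf _).trans ?_
  gcongr
  exact Sobolev.norm_apply_le v _

/-- Exchanging one factor at a time leaves a single difference `d` in each term. In that direction
the kernel is a `k`-th derivative and can be integrated by parts. -/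
theorem torusKernel_telescope (x : T3) {a b d : ℝ → ℝ} (h : ∀ t, b t = a t + d t) (y : T3) :
    torusKernel x ![b, b, b] y - torusKernel x ![a, a, a] y =
      torusKernel x ![d, a, a] y + torusKernel x ![b, d, a] y + torusKernel x ![b, b, d] y := by
  have hb : ∀ y, circ b y = circ a y + circ d y := fun y => by
    rw [← circ_add, ← funext h]
  simp [torusKernel, Fin.prod_univ_three, hb]
  ring

/-- The mollification of `g` at scale `2^{-m}`. -/
noncomputable def mollify (m : ℕ) (g : T3 → ℝ) (x : T3) : ℝ :=
  ∫ y, torusKernel x ![mollifierAt m, mollifierAt m, mollifierAt m] y * g y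

theorem integrable_torusKernel_mul {p : ℝ≥0∞} [Fact (1 ≤ p)] (x : T3) {f : Fin 3 → ℝ → ℝ}
    (hf : ∀ j, IsBump (1 / 2) (f j)) (v : Lp ℝ p (volume : Measure T3)) :
    Integrable (fun y => torusKernel x f y * v y) volume :=
  integrable_smul_Lp (smooth_torusKernel x hf).continuous v

theorem half_div_two_pow_le (m : ℕ) : (1 : ℝ) / 2 / 2 ^ m ≤ 1 / 2 :=
  div_le_self (by norm_num) (one_le_pow₀ one_le_two)

theorem exists_abs_mollifierAt_le :
    ∃ C : ℝ, 0 ≤ C ∧ ∀ m t, |mollifierAt m t| ≤ C * 2 ^ m := by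
  obtain ⟨C, h0, hC⟩ := isBump_mollifier.exists_bound
  refine ⟨C, h0, fun m t => ?_⟩
  rw [mollifierAt, abs_mul, abs_of_pos (by positivity), mul_comm]
  gcongr
  exact hC _

theorem exists_abs_mollifierDiff_le (k : ℕ) :
    ∃ C : ℝ, 0 ≤ C ∧ ∀ m t, |mollifierDiff k m t| ≤ C * (2 ^ m / (2 ^ m) ^ k) := by
  obtain ⟨C, h0, hC⟩ := (isBump_rampDiff.iteratedDeriv (2 - k)).exists_bound
  refine ⟨C, h0, fun m t => ?_⟩
  rw [mollifierDiff, abs_mul, abs_of_pos (by positivity), mul_comm]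
  gcongr
  exact hC _

/-- The scale count of one telescoped term: two mollifier factors of size `2 ^ m`, one factor from
`mollifierDiff`, and the Hölder factor of a cube of side `2⁻ᵐ`. -/
theorem two_pow_scaling (k m : ℕ) (P : ℝ) :
    ((2 : ℝ) ^ m) ^ 2 * (2 ^ m / (2 ^ m) ^ k) * ((2 * (1 / 2 / 2 ^ m)) ^ 3) ^ (1 - 1 / P) =
      (2 ^ (3 / P - k)) ^ m := by
  have h : ∀ n : ℕ, ((2 : ℝ) ^ m) ^ n = 2 ^ ((m : ℝ) * n) := fun n => by
    rw [Real.rpow_mul two_pos.le, Real.rpow_natCast, Real.rpow_natCast]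
  have h1 : (2 * (1 / 2 / 2 ^ m : ℝ)) = 2 ^ (-(m : ℝ)) := by
    rw [Real.rpow_neg two_pos.le, Real.rpow_natCast]
    field_simp
  rw [h1, h, h, ← Real.rpow_natCast 2 m, ← Real.rpow_natCast _ 3, ← Real.rpow_mul two_pos.le,
    ← Real.rpow_mul two_pos.le, ← Real.rpow_sub two_pos, ← Real.rpow_add two_pos,
    ← Real.rpow_add two_pos, ← Real.rpow_natCast _ m, ← Real.rpow_mul two_pos.le]
  congr 1
  push_cast
  ring

theorem exists_abs_mollify_succ_sub_le {k : ℕ} (hk : k ≤ 2) (p : ℝ≥0∞) [Fact (1 ≤ p)] :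
    ∃ C : ℝ, 0 ≤ C ∧ ∀ (v : Sobolev k p ℝ) (x : T3) (m : ℕ),
      |mollify (m + 1) (Sobolev.fn v) x - mollify m (Sobolev.fn v) x| ≤
        C * ‖v‖ * (2 ^ (3 / p.toReal - k)) ^ m := by
  obtain ⟨A, hA0, hA⟩ := exists_abs_mollifierAt_le
  obtain ⟨B, hB0, hB⟩ := exists_abs_mollifierDiff_le k
  -- Three telescoped terms. The constant `A * 2` bounds both `mollifierAt m` and `mollifierAt (m +
  -- 1)` relative to `2 ^ m`.
  refine ⟨3 * ((A * 2) ^ 2 * B), by positivity, fun v x m => ?_⟩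
  set a := mollifierAt m
  set b := mollifierAt (m + 1)
  set z := mollifierDiff k m
  set d := iteratedDeriv k z
  set r : ℝ := 1 / 2 / 2 ^ m
  have hr0 : 0 ≤ r := by positivity
  have hr : r ≤ 1 / 2 := half_div_two_pow_le m
  have hba : IsBump r a := isBump_mollifierAt m
  have hbb : IsBump r b := (isBump_mollifierAt (m + 1)).mono (by
    simp only [r]; gcongr <;> norm_num)
  have hbz : IsBump r z := isBump_mollifierDiff k m
  have hbd : IsBump r d := hbz.iteratedDeriv k
  have ha : ∀ t, |a t| ≤ A * 2 * 2 ^ m := fun t => (hA m t).trans (by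
    have : 0 ≤ A * 2 ^ m := by positivity
    linarith)
  have hb : ∀ t, |b t| ≤ A * 2 * 2 ^ m := fun t => (hA (m + 1) t).trans (by
    rw [pow_succ]; linarith)
  have hz : ∀ t, |z t| ≤ B * (2 ^ m / (2 ^ m) ^ k) := hB m
  have hint : ∀ f : Fin 3 → ℝ → ℝ, (∀ j, IsBump r (f j)) →
      Integrable (fun y => torusKernel x f y * Sobolev.fn v y) volume := fun f hf =>
    integrable_torusKernel_mul x (fun j => (hf j).mono hr) _
  have h3 : ∀ f₀ f₁ f₂ : ℝ → ℝ, IsBump r f₀ → IsBump r f₁ → IsBump r f₂ →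
      ∀ j, IsBump r (![f₀, f₁, f₂] j) := by
    intro f₀ f₁ f₂ h0 h1 h2 j
    fin_cases j
    exacts [h0, h1, h2]
  have hdiff : mollify (m + 1) (Sobolev.fn v) x - mollify m (Sobolev.fn v) x =
      (∫ y, torusKernel x ![d, a, a] y * Sobolev.fn v y) +
        (∫ y, torusKernel x ![b, d, a] y * Sobolev.fn v y) +
        ∫ y, torusKernel x ![b, b, d] y * Sobolev.fn v y := by
    rw [mollify, mollify, ← integral_sub (hint _ (h3 _ _ _ hbb hbb hbb))
      (hint _ (h3 _ _ _ hba hba hba)), ← integral_add (hint _ (h3 _ _ _ hbd hba hba))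
      (hint _ (h3 _ _ _ hbb hbd hba)), ← integral_add]
    · refine integral_congr_ae (Eventually.of_forall fun y => ?_)
      simp only
      rw [← sub_mul, torusKernel_telescope x (d := d) _ y]
      · ring
      · intro t
        simp only [d, z, a, b, iteratedDeriv_mollifierDiff hk]
        ring
    · exact (hint _ (h3 _ _ _ hbd hba hba)).add (hint _ (h3 _ _ _ hbb hbd hba))
    · exact hint _ (h3 _ _ _ hbb hbb hbd)
  have key : ∀ f : Fin 3 → ℝ → ℝ, (∀ j, IsBump r (f j)) → ∀ C : Fin 3 → ℝ,
      (∀ j t, |f j t| ≤ C j) →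
      ∏ j, C j = (A * 2 * 2 ^ m) ^ 2 * (B * (2 ^ m / (2 ^ m) ^ k)) → ∀ j,
      |∫ y, torusKernel x (Function.update f j (iteratedDeriv k (f j))) y * Sobolev.fn v y| ≤
        (A * 2) ^ 2 * B * ‖v‖ * (2 ^ (3 / p.toReal - k)) ^ m := by
    intro f hf C hC hprod j
    refine (Sobolev.abs_integral_torusKernel_update_le v x hC hr0 hr hf j).trans (le_of_eq ?_)
    rw [hprod, ← two_pow_scaling]
    ring
  have k0 := key ![z, a, a] (h3 _ _ _ hbz hba hba)
    ![B * (2 ^ m / (2 ^ m) ^ k), A * 2 * 2 ^ m, A * 2 * 2 ^ m]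
    (by intro j t; fin_cases j; exacts [hz t, ha t, ha t])
    (by rw [Fin.prod_univ_three]; simp only [Matrix.cons_val]; ring) 0
  have k1 := key ![b, z, a] (h3 _ _ _ hbb hbz hba)
    ![A * 2 * 2 ^ m, B * (2 ^ m / (2 ^ m) ^ k), A * 2 * 2 ^ m]
    (by intro j t; fin_cases j; exacts [hb t, hz t, ha t])
    (by rw [Fin.prod_univ_three]; simp only [Matrix.cons_val]; ring) 1
  have k2 := key ![b, b, z] (h3 _ _ _ hbb hbb hbz)
    ![A * 2 * 2 ^ m, A * 2 * 2 ^ m, B * (2 ^ m / (2 ^ m) ^ k)]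
    (by intro j t; fin_cases j; exacts [hb t, hb t, hz t])
    (by rw [Fin.prod_univ_three]; simp only [Matrix.cons_val]; ring) 2
  have u0 : Function.update ![z, a, a] 0 (iteratedDeriv k (![z, a, a] 0)) = ![d, a, a] := by
    funext i; fin_cases i <;> rfl
  have u1 : Function.update ![b, z, a] 1 (iteratedDeriv k (![b, z, a] 1)) = ![b, d, a] := by
    funext i; fin_cases i <;> rfl
  have u2 : Function.update ![b, b, z] 2 (iteratedDeriv k (![b, b, z] 2)) = ![b, b, d] := by
    funext i; fin_cases i <;> rfl
  rw [u0] at k0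
  rw [u1] at k1
  rw [u2] at k2
  rw [hdiff]
  refine (abs_add_three _ _ _).trans ?_
  linarith

theorem exists_abs_mollify_zero_le {k : ℕ} (p : ℝ≥0∞) [Fact (1 ≤ p)] :
    ∃ C : ℝ, 0 ≤ C ∧ ∀ (v : Sobolev k p ℝ) (x : T3), |mollify 0 (Sobolev.fn v) x| ≤ C * ‖v‖ := by
  obtain ⟨A, hA0, hA⟩ := exists_abs_mollifierAt_le
  refine ⟨A ^ 3, by positivity, fun v x => ?_⟩
  have h := abs_integral_torusKernel_mul_le x
    (f := ![mollifierAt 0, mollifierAt 0, mollifierAt 0]) (C := fun _ => A)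
    (by intro j t; have := hA 0 t; rw [pow_zero, mul_one] at this; fin_cases j <;> exact this)
    (r := 1 / 2) (by norm_num)
    (by
      have := isBump_mollifierAt 0
      rw [pow_zero, div_one] at this
      intro j; fin_cases j <;> exact this) (v.1 (MultiIdx.zero k))
  rw [Finset.prod_const, Finset.card_univ, Fintype.card_fin, mul_one_div_cancel two_ne_zero,
    one_pow, Real.one_rpow, one_mul] at h
  refine h.trans ?_
  gcongr
  exact Sobolev.norm_apply_le v _

theorem tendsto_mollify {w : T3 → ℝ} (hw : Continuous w) (x : T3) :
    Tendsto (fun m => mollify m w x) atTop (𝓝 (w x)) := by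
  obtain ⟨A, hA0, hA⟩ := exists_abs_mollifierAt_le
  rw [Metric.tendsto_atTop]
  intro ε hε
  -- The supremum of the kernel times the volume of its cube is at most `A ^ 3` at every scale. The
  -- `+ 1` keeps the denominator positive.
  obtain ⟨δ, hδ, hwδ⟩ := Metric.continuous_iff.mp hw x (ε / (2 * (A ^ 3 + 1))) (by positivity)
  obtain ⟨N, hN⟩ := exists_pow_lt_of_lt_one hδ (by norm_num : (1 / 2 : ℝ) < 1)
  refine ⟨N, fun m hm => ?_⟩
  set f : Fin 3 → ℝ → ℝ := ![mollifierAt m, mollifierAt m, mollifierAt m]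
  set r : ℝ := 1 / 2 / 2 ^ m
  have hf : ∀ j, IsBump r (f j) := by
    intro j; fin_cases j <;> exact isBump_mollifierAt m
  have hfA : ∀ j t, |f j t| ≤ A * 2 ^ m := by
    intro j t; fin_cases j <;> exact hA m t
  have hr0 : 0 ≤ r := by positivity
  have hrδ : r < δ := by
    refine lt_of_le_of_lt ?_ hN
    calc r ≤ 1 / 2 ^ m := by
          simp only [r]; gcongr; norm_num
      _ ≤ 1 / 2 ^ N := by gcongr; norm_num
      _ = (1 / 2) ^ N := by rw [one_div_pow]
  have hcont : Continuous (torusKernel x f) :=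
    (smooth_torusKernel x fun j => (hf j).mono (half_div_two_pow_le m)).continuous
  have hi1 : Integrable (fun y => torusKernel x f y * w y) (volume : Measure T3) :=
    (hcont.mul hw).integrable_of_hasCompactSupport (HasCompactSupport.of_compactSpace _)
  have hi2 : Integrable (fun y => torusKernel x f y * w x) (volume : Measure T3) :=
    (hcont.mul continuous_const).integrable_of_hasCompactSupport
      (HasCompactSupport.of_compactSpace _)
  have hone : ∫ y, torusKernel x f y = 1 := by
    rw [integral_torusKernel]
    refine Finset.prod_eq_one fun j _ => ?_
    fin_cases j <;> exact integral_mollifierAt m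
  have heq : mollify m w x - w x = ∫ y, torusKernel x f y * (w y - w x) := by
    simp only [mul_sub]
    rw [integral_sub hi1 hi2, integral_mul_const, hone, one_mul]
    rfl
  rw [dist_eq_norm, heq, ← setIntegral_eq_integral_of_forall_compl_eq_zero
    (s := Metric.closedBall x r)]
  · have hvol : (volume : Measure T3).real (Metric.closedBall x r) ≤ (2 * r) ^ 3 :=
      ENNReal.toReal_le_of_le_ofReal (by positivity) (volume_closedBall_le x hr0)
    calc ‖∫ y in Metric.closedBall x r, torusKernel x f y * (w y - w x)‖
        ≤ (A * 2 ^ m) ^ 3 * (ε / (2 * (A ^ 3 + 1))) *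
            (volume : Measure T3).real (Metric.closedBall x r) := by
          refine norm_setIntegral_le_of_norm_le_const (measure_lt_top _ _) fun y hy => ?_
          rw [norm_mul, Real.norm_eq_abs, ← dist_eq_norm]
          have h1 := abs_torusKernel_le x (C := fun _ => A * 2 ^ m) hfA y
          rw [Finset.prod_const, Finset.card_univ, Fintype.card_fin] at h1
          gcongr
          exact (hwδ y (lt_of_le_of_lt hy hrδ)).le
      _ ≤ (A * 2 ^ m) ^ 3 * (ε / (2 * (A ^ 3 + 1))) * (2 * r) ^ 3 := by gcongr
      _ = A ^ 3 / (A ^ 3 + 1) * (ε / 2) := by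
          simp only [r]
          field_simp
      _ ≤ 1 * (ε / 2) := by
          gcongr
          rw [div_le_one (by positivity)]
          linarith
      _ < ε := by linarith
  · intro y hy
    by_contra hc
    exact hy (mem_closedBall_of_torusKernel_ne_zero hf (left_ne_zero_of_mul hc))

/-- Morrey's inequality for functions that have a continuous representative. -/
theorem Sobolev.exists_abs_le {k : ℕ} (hk : k ≤ 2) (p : ℝ≥0∞) [Fact (1 ≤ p)]
    (hkp : 3 / p.toReal < k) :
    ∃ C : ℝ, 0 < C ∧ ∀ (v : Sobolev k p ℝ) (w : C(T3, ℝ)), Sobolev.fn v =ᵐ[volume] w →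
      ∀ x, |w x| ≤ C * ‖v‖ := by
  obtain ⟨A, hA0, hA⟩ := exists_abs_mollify_succ_sub_le hk p
  obtain ⟨B, hB0, hB⟩ := exists_abs_mollify_zero_le (k := k) p
  set ρ : ℝ := 2 ^ (3 / p.toReal - k)
  have hρ0 : 0 ≤ ρ := by positivity
  have hρ1 : ρ < 1 := Real.rpow_lt_one_of_one_lt_of_neg one_lt_two (by linarith)
  have hρ2 : 0 ≤ (1 - ρ)⁻¹ := inv_nonneg.mpr (by linarith)
  refine ⟨B + A * (1 - ρ)⁻¹ + 1, by positivity, fun v w hvw x => ?_⟩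
  -- The increments form a geometric series of ratio `ρ < 1`, which is where `3 / p < k` is used.
  -- The representative inherits the bound as the limit of the mollifications.
  have hb : ∀ m, |mollify m (Sobolev.fn v) x| ≤
      B * ‖v‖ + A * ‖v‖ * ∑ i ∈ Finset.range m, ρ ^ i := by
    intro m
    induction m with
    | zero => simpa using hB v x
    | succ m ih =>
      have h1 := abs_sub_abs_le_abs_sub (mollify (m + 1) (Sobolev.fn v) x)
        (mollify m (Sobolev.fn v) x)
      have h2 := hA v x m
      rw [Finset.sum_range_succ, mul_add]
      linarith
  have hb' : ∀ m, |mollify m (Sobolev.fn v) x| ≤ (B + A * (1 - ρ)⁻¹ + 1) * ‖v‖ := by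
    intro m
    have h1 : ∑ i ∈ Finset.range m, ρ ^ i ≤ (1 - ρ)⁻¹ := by
      rw [← tsum_geometric_of_lt_one hρ0 hρ1]
      exact (summable_geometric_of_lt_one hρ0 hρ1).sum_le_tsum _ fun i _ => by positivity
    have h2 : A * ‖v‖ * ∑ i ∈ Finset.range m, ρ ^ i ≤ A * ‖v‖ * (1 - ρ)⁻¹ := by gcongr
    have h3 := norm_nonneg v
    have := hb m
    linarith
  have heq : ∀ m, mollify m (Sobolev.fn v) x = mollify m w x := fun m => integral_congr_ae (by
    filter_upwards [hvw] with y hy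
    rw [hy])
  simp only [heq] at hb'
  exact le_of_tendsto' (tendsto_mollify w.continuous x).abs hb'

/-! ### Weak convergence. -/

section WeakConvergence

/-- Weak convergence of a sequence in a normed space. -/
def WeakConv {H : Type*} [NormedAddCommGroup H] [NormedSpace ℝ H] (b : ℕ → H) (a : H) : Prop :=
  ∀ f : H →L[ℝ] ℝ, Tendsto (fun n => f (b n)) atTop (𝓝 (f a))

variable {H K : Type*} [NormedAddCommGroup H] [NormedSpace ℝ H]
  [NormedAddCommGroup K] [NormedSpace ℝ K]

theorem WeakConv.map {b : ℕ → H} {a : H} (h : WeakConv b a) (T : H →L[ℝ] K) :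
    WeakConv (fun n => T (b n)) (T a) :=
  fun f => h (f.comp T)

theorem WeakConv.const (a : H) : WeakConv (fun _ => a) a := fun _ => tendsto_const_nhds

theorem WeakConv.add {b c : ℕ → H} {a d : H} (h : WeakConv b a) (h' : WeakConv c d) :
    WeakConv (fun n => b n + c n) (a + d) := fun f => by
  simpa only [map_add] using (h f).add (h' f)

theorem WeakConv.const_smul {b : ℕ → H} {a : H} (h : WeakConv b a) (c : ℝ) :
    WeakConv (fun n => c • b n) (c • a) := fun f => by
  simpa only [map_smul] using (h f).const_smul c

/-- Mazur's theorem by Hahn–Banach separation. Asking only for frequent membership is what lets the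
lower semicontinuity proofs negate an eventual strict inequality. -/
theorem WeakConv.mem_of_frequently {b : ℕ → H} {a : H} (h : WeakConv b a) {s : Set H}
    (hs : Convex ℝ s) (hs' : IsClosed s) (hb : ∃ᶠ n in atTop, b n ∈ s) : a ∈ s := by
  by_contra ha
  obtain ⟨f, u, hu, hf⟩ := geometric_hahn_banach_closed_point hs hs' ha
  obtain ⟨n, hn, hn'⟩ := (hb.and_eventually ((h f).eventually (lt_mem_nhds hf))).exists
  exact lt_asymm (hu _ hn) hn'

theorem WeakConv.eq_of_const {a b : H} (h : WeakConv (fun _ => b) a) : a = b :=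
  h.mem_of_frequently (convex_singleton b) isClosed_singleton
    (Frequently.of_forall fun _ => rfl)

end WeakConvergence

section Hilbert

variable {𝕜 H : Type*} [RCLike 𝕜] [NormedAddCommGroup H] [InnerProductSpace 𝕜 H]

/-- For a bounded sequence, testing on a total set is enough: replacing `g` by a nearby `d` in the
span costs at most `‖g - d‖ * R`, uniformly in `n`. -/
theorem tendsto_inner_of_forall_mem {b : ℕ → H} {a : H} {C : ℝ} (hC : ∀ᶠ n in atTop, ‖b n‖ ≤ C)
    {s : Set H} (hs : Dense (Submodule.span 𝕜 s : Set H))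
    (h : ∀ d ∈ s, Tendsto (fun n => inner 𝕜 d (b n)) atTop (𝓝 (inner 𝕜 d a))) (g : H) :
    Tendsto (fun n => inner 𝕜 g (b n)) atTop (𝓝 (inner 𝕜 g a)) := by
  have h1 : ∀ d ∈ Submodule.span 𝕜 s,
      Tendsto (fun n => inner 𝕜 d (b n)) atTop (𝓝 (inner 𝕜 d a)) := by
    intro d hd
    induction hd using Submodule.span_induction with
    | mem x hx => exact h x hx
    | zero => simp
    | add x y _ _ hx hy => simpa only [inner_add_left] using hx.add hy
    | smul c x _ hx => simpa only [inner_smul_left] using hx.const_mul _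
  rw [Metric.tendsto_atTop']
  intro ε hε
  set R := max C 0 + ‖a‖ + 1
  have hR : 0 < R := by positivity
  obtain ⟨d, hd, hgd⟩ := Metric.dense_iff.mp hs g (ε / (2 * R)) (by positivity)
  rw [Metric.mem_ball, dist_comm, dist_eq_norm] at hd
  obtain ⟨N, hN⟩ := eventually_atTop.mp
    (hC.and ((Metric.tendsto_nhds.mp (h1 d hgd)) (ε / 2) (by positivity)))
  refine ⟨N, fun n hn => ?_⟩
  obtain ⟨hb, hd'⟩ := hN n hn.le
  rw [dist_eq_norm] at hd' ⊢
  have e1 : inner 𝕜 g (b n) - inner 𝕜 g a =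
      inner 𝕜 (g - d) (b n - a) + (inner 𝕜 d (b n) - inner 𝕜 d a) := by
    simp only [inner_sub_left, inner_sub_right]
    ring
  rw [e1]
  have e2 : ‖inner 𝕜 (g - d) (b n - a)‖ ≤ ε / (2 * R) * R := by
    refine (norm_inner_le_norm _ _).trans ?_
    have : ‖b n - a‖ ≤ R := (norm_sub_le _ _).trans (by
      have := hb.trans (le_max_left C 0)
      simp only [R]; linarith)
    gcongr
  have e3 : ε / (2 * R) * R = ε / 2 := by field_simp
  rw [e3] at e2
  calc _ ≤ _ := norm_add_le _ _
    _ < ε / 2 + ε / 2 := by linarith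
    _ = ε := by ring

theorem weakConv_of_tendsto_inner {H : Type*} [NormedAddCommGroup H] [InnerProductSpace ℝ H]
    [CompleteSpace H] {b : ℕ → H} {a : H}
    (h : ∀ g, Tendsto (fun n => inner ℝ g (b n)) atTop (𝓝 (inner ℝ g a))) : WeakConv b a := by
  intro f
  simpa only [InnerProductSpace.toDual_symm_apply] using
    h ((InnerProductSpace.toDual ℝ H).symm f)

end Hilbert

/-! ### Density of smooth test functions in `L²`. -/

section Density

theorem T3.Smooth.const (c : ℝ) : T3.Smooth (fun _ => c) := contDiff_const

theorem T3.Smooth.mul {φ ψ : T3 → ℝ} (h : T3.Smooth φ) (h' : T3.Smooth ψ) :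
    T3.Smooth (fun x => φ x * ψ x) := ContDiff.mul h h'

theorem T3.Smooth.add {φ ψ : T3 → ℝ} (h : T3.Smooth φ) (h' : T3.Smooth ψ) :
    T3.Smooth (fun x => φ x + ψ x) := ContDiff.add h h'

/-- The algebra of smooth functions on the torus. -/
noncomputable def smoothSubalgebra : Subalgebra ℝ C(T3, ℝ) where
  carrier := {g | T3.Smooth g}
  mul_mem' := fun ha hb => T3.Smooth.mul ha hb
  add_mem' := fun ha hb => T3.Smooth.add ha hb
  algebraMap_mem' := fun r => T3.Smooth.const r

theorem contDiff_fourier_one_comp :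
    ContDiff ℝ ∞ (fun t : ℝ => fourier 1 (t : AddCircle (2 : ℝ))) := by
  simp only [fourier_coe_apply]
  exact Complex.contDiff_exp.comp (((contDiff_const.mul Complex.ofRealCLM.contDiff)).div_const _)

theorem smooth_re_fourier (j : Fin 3) :
    T3.Smooth (fun x => (fourier 1 (x j) : ℂ).re) :=
  Complex.reCLM.contDiff.comp (contDiff_fourier_one_comp.comp (contDiff_apply ℝ ℝ j))

theorem smooth_im_fourier (j : Fin 3) :
    T3.Smooth (fun x => (fourier 1 (x j) : ℂ).im) :=
  Complex.imCLM.contDiff.comp (contDiff_fourier_one_comp.comp (contDiff_apply ℝ ℝ j))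

/-- The character `fourier 1` is injective on the circle, so its real or imaginary part in a
coordinate where the points differ separates them. -/
theorem separatesPoints_smoothSubalgebra : smoothSubalgebra.SeparatesPoints := by
  intro x y hxy
  obtain ⟨j, hj⟩ := Function.ne_iff.mp hxy
  have hne : (fourier 1 (x j) : ℂ) ≠ fourier 1 (y j) := by
    rw [fourier_one, fourier_one]
    intro h
    exact hj (AddCircle.injective_toCircle two_ne_zero (Subtype.ext h))
  by_cases hre : (fourier 1 (x j) : ℂ).re = (fourier 1 (y j) : ℂ).re
  · refine ⟨fun x => (fourier 1 (x j) : ℂ).im, ⟨⟨_, (smooth_im_fourier j).continuous⟩,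
      smooth_im_fourier j, rfl⟩, fun him => hne (Complex.ext hre him)⟩
  · exact ⟨fun x => (fourier 1 (x j) : ℂ).re, ⟨⟨_, (smooth_re_fourier j).continuous⟩,
      smooth_re_fourier j, rfl⟩, hre⟩

/-- Stone–Weierstrass passes from smooth to continuous test functions, and continuous functions are
dense in `L²`. -/
theorem ae_eq_zero_of_integral_smooth_mul (h : Lp ℝ 2 (volume : Measure T3))
    (h0 : ∀ φ : T3 → ℝ, T3.Smooth φ → ∫ x, φ x * h x = 0) : h = 0 := by
  have hint : Integrable h volume := (Lp.memLp h).integrable one_le_two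
  have h1 : ∀ g : C(T3, ℝ), ∫ x, g x * h x = 0 := by
    intro g
    have hc : Continuous fun g : C(T3, ℝ) => ∫ x, g x * h x := by
      have hadd : ∀ g g' : C(T3, ℝ),
          ∫ x, (g - g') x * h x = (∫ x, g x * h x) - ∫ x, g' x * h x := by
        intro g g'
        have h1 : Integrable (fun x => g x * h x) volume := integrable_smul_Lp g.continuous h
        have h2 : Integrable (fun x => g' x * h x) volume := integrable_smul_Lp g'.continuous h
        rw [← integral_sub h1 h2]
        simp [sub_mul]
      refine (LipschitzWith.of_dist_le_mul (K := (∫ x, ‖h x‖).toNNReal) fun g g' => ?_).continuous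
      rw [dist_eq_norm, dist_eq_norm, ← hadd,
        Real.coe_toNNReal _ (integral_nonneg fun _ => norm_nonneg _),
        mul_comm, ← integral_const_mul]
      refine norm_integral_le_of_norm_le (hint.norm.const_mul _) (Eventually.of_forall fun x => ?_)
      rw [norm_mul]
      gcongr
      exact (g - g').norm_coe_le_norm x
    have hcl : IsClosed {g : C(T3, ℝ) | ∫ x, g x * h x = 0} := isClosed_eq hc continuous_const
    have hmem := ContinuousMap.continuousMap_mem_subalgebra_closure_of_separatesPoints
      smoothSubalgebra separatesPoints_smoothSubalgebra g
    have hsub : (smoothSubalgebra : Set C(T3, ℝ)) ⊆ {g : C(T3, ℝ) | ∫ x, g x * h x = 0} :=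
      fun g hg => h0 g hg
    exact closure_minimal hsub hcl hmem
  have h2 : ∀ g : Lp ℝ 2 (volume : Measure T3), inner ℝ g h = 0 := by
    intro g
    have hd := ContinuousMap.toLp_denseRange ℝ (volume : Measure T3) ℝ (p := 2) (by simp)
    refine hd.induction_on (p := fun g => inner ℝ g h = 0) g
      (isClosed_eq (continuous_id.inner continuous_const) continuous_const) fun g => ?_
    rw [L2.inner_def, ← h1 g]
    refine integral_congr_ae ?_
    filter_upwards [ContinuousMap.coeFn_toLp (p := 2) (𝕜 := ℝ) (volume : Measure T3) g] with x hx
    rw [hx]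
    simp [mul_comm]
  exact inner_self_eq_zero.mp (h2 h)

variable {E : Type*} [NormedAddCommGroup E] [InnerProductSpace ℝ E]

theorem memLp_smul_const {φ : T3 → ℝ} (hφ : Continuous φ) (e : E) :
    MemLp (fun x => φ x • e) 2 (volume : Measure T3) := by
  obtain ⟨C, hC⟩ := isCompact_univ.exists_bound_of_continuousOn (f := fun x => φ x • e)
    (by fun_prop)
  exact MemLp.of_bound (hφ.aestronglyMeasurable.smul_const e) C
    (Eventually.of_forall fun x => hC x trivial)

/-- The element `φ e` of `L²(𝕋³; E)`. -/
noncomputable def testL2 {φ : T3 → ℝ} (hφ : Continuous φ) (e : E) :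
    Lp E 2 (volume : Measure T3) := (memLp_smul_const hφ e).toLp _

theorem inner_testL2 {φ : T3 → ℝ} (hφ : Continuous φ) (e : E) (h : Lp E 2 (volume : Measure T3)) :
    inner ℝ (testL2 hφ e) h = ∫ x, φ x * inner ℝ e (h x) := by
  rw [L2.inner_def]
  refine integral_congr_ae ?_
  filter_upwards [(memLp_smul_const hφ e).coeFn_toLp] with x hx
  rw [testL2, hx, inner_smul_left]
  rfl

variable [CompleteSpace E]

theorem inner_testL2_eq_inner_integral {φ : T3 → ℝ} (hφ : Continuous φ) (e : E)
    (h : Lp E 2 (volume : Measure T3)) :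
    inner ℝ (testL2 hφ e) h = inner ℝ e (∫ x, φ x • h x) := by
  rw [inner_testL2, ← integral_inner (integrable_smul_Lp hφ h)]
  simp only [inner_smul_right]

theorem dense_span_testL2 [SecondCountableTopology E] :
    Dense (Submodule.span ℝ {g : Lp E 2 (volume : Measure T3) |
      ∃ (φ : T3 → ℝ) (hφ : T3.Smooth φ) (e : E), testL2 hφ.continuous e = g} :
      Set (Lp E 2 (volume : Measure T3))) := by
  rw [Submodule.dense_iff_topologicalClosure_eq_top, Submodule.topologicalClosure_eq_top_iff,
    Submodule.eq_bot_iff]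
  intro h hh
  rw [Submodule.mem_orthogonal] at hh
  have h1 : ∀ e : E, (fun x => inner ℝ e (h x)) =ᵐ[volume] 0 := by
    intro e
    have hL := (innerSL ℝ e).coeFn_compLp h
    have : (innerSL ℝ e).compLp h = 0 := by
      refine ae_eq_zero_of_integral_smooth_mul _ fun φ hφ => ?_
      rw [← hh _ (Submodule.subset_span ⟨φ, hφ, e, rfl⟩), inner_testL2]
      refine integral_congr_ae ?_
      filter_upwards [hL] with x hx
      rw [hx, innerSL_apply_apply]
    filter_upwards [hL, Lp.eq_zero_iff_ae_eq_zero.mp this] with x hx hx'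
    rw [hx'] at hx
    simpa using hx.symm
  exact Lp.eq_zero_iff_ae_eq_zero.mpr (ae_eq_zero_of_forall_inner (𝕜 := ℝ) h1)

end Density

/-! ### Weak lower semicontinuity of `L^p` norms. -/

/-- Fatou's lemma: `L²` convergence implies convergence in measure, under which `eLpNorm` is lower
semicontinuous, infinite values included. -/
theorem isClosed_setOf_eLpNorm_le {E : Type*} [NormedAddCommGroup E] {p : ℝ≥0∞} (C : ℝ≥0∞) :
    IsClosed {g : Lp E 2 (volume : Measure T3) | eLpNorm g p volume ≤ C} := by
  refine IsSeqClosed.isClosed fun g g₀ hg hlim => ?_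
  exact eLpNorm_le_of_tendstoInMeasure (Eventually.of_forall hg)
    (tendstoInMeasure_of_tendsto_Lp hlim) fun n => (Lp.memLp (g n)).1

section Inclusion

variable {E : Type*} [NormedAddCommGroup E] [NormedSpace ℝ E] {p : ℝ≥0∞} [Fact (1 ≤ p)]

/-- The inclusion `L^p ⊆ L²`, `p ≥ 2`, on the torus. -/
noncomputable def inclL2 (hp : 2 ≤ p) :
    Lp E p (volume : Measure T3) →L[ℝ] Lp E 2 (volume : Measure T3) :=
  LinearMap.mkContinuous
    { toFun := fun v => ((Lp.memLp v).mono_exponent hp).toLp v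
      map_add' := fun v w => by
        rw [← MemLp.toLp_add]
        exact MemLp.toLp_congr _ _ (Lp.coeFn_add v w)
      map_smul' := fun c v => by
        rw [RingHom.id_apply, ← MemLp.toLp_const_smul]
        exact MemLp.toLp_congr _ _ (Lp.coeFn_smul c v) }
    ((volume (Set.univ : Set T3)).toReal ^ (1 / (2 : ℝ≥0∞).toReal - 1 / p.toReal)) (by
      intro v
      have hp1 : (1 : ℝ≥0∞) ≤ p := Fact.out
      have hpr : 0 ≤ 1 / (2 : ℝ≥0∞).toReal - 1 / p.toReal := by
        rcases eq_or_ne p ⊤ with rfl | hp'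
        · simp
        · have : (2 : ℝ≥0∞).toReal ≤ p.toReal := ENNReal.toReal_mono hp' hp
          exact sub_nonneg.mpr (one_div_le_one_div_of_le (by norm_num) this)
      have h := eLpNorm_le_eLpNorm_mul_rpow_measure_univ hp (Lp.memLp v).1
      simp only [LinearMap.coe_mk, AddHom.coe_mk]
      rw [Lp.norm_toLp, Lp.norm_def, ENNReal.toReal_rpow, mul_comm, ← ENNReal.toReal_mul]
      exact ENNReal.toReal_mono (ENNReal.mul_ne_top (Lp.memLp v).2.ne
        (ENNReal.rpow_ne_top_of_nonneg hpr (measure_ne_top _ _))) h)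

theorem coeFn_inclL2 (hp : 2 ≤ p) (v : Lp E p (volume : Measure T3)) :
    (inclL2 hp v : T3 → E) =ᵐ[volume] v :=
  MemLp.coeFn_toLp ((Lp.memLp v).mono_exponent hp)

theorem inclL2_injective (hp : 2 ≤ p) :
    Function.Injective (inclL2 hp : Lp E p (volume : Measure T3) → Lp E 2 volume) := by
  intro v w h
  refine Lp.ext ?_
  have h1 := coeFn_inclL2 hp v
  rw [h] at h1
  exact h1.symm.trans (coeFn_inclL2 hp w)

theorem convex_setOf_eLpNorm_le (C : ℝ≥0∞) :
    Convex ℝ {g : Lp E 2 (volume : Measure T3) | eLpNorm g p volume ≤ C} := by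
  intro g hg g' hg' a b ha hb hab
  have h1 : ((a • g + b • g' : Lp E 2 (volume : Measure T3)) : T3 → E) =ᵐ[volume]
      a • (g : T3 → E) + b • (g' : T3 → E) := by
    filter_upwards [Lp.coeFn_add (a • g) (b • g'), Lp.coeFn_smul a g, Lp.coeFn_smul b g']
      with x h1 h2 h3
    rw [h1, Pi.add_apply, Pi.add_apply, h2, h3]
  have hnn : ∀ c : ℝ, 0 ≤ c → ‖c‖ₑ = ENNReal.ofReal c := fun c hc => Real.enorm_of_nonneg hc
  rw [Set.mem_ofPred_eq] at hg hg' ⊢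
  rw [eLpNorm_congr_ae h1]
  calc eLpNorm (a • (g : T3 → E) + b • (g' : T3 → E)) p volume
      ≤ eLpNorm (a • (g : T3 → E)) p volume + eLpNorm (b • (g' : T3 → E)) p volume :=
        eLpNorm_add_le ((Lp.memLp g).1.const_smul a) ((Lp.memLp g').1.const_smul b) Fact.out
    _ = ENNReal.ofReal a * eLpNorm g p volume + ENNReal.ofReal b * eLpNorm g' p volume := by
        rw [eLpNorm_const_smul, eLpNorm_const_smul, hnn a ha, hnn b hb]
    _ ≤ ENNReal.ofReal a * C + ENNReal.ofReal b * C := by gcongr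
    _ = C := by rw [← add_mul, ← ENNReal.ofReal_add ha hb, hab, ENNReal.ofReal_one, one_mul]

/-- The `L^p` balls are convex and closed as subsets of `L²`, hence weakly closed there. All weak
convergence can thus be tested in the Hilbert space `L²`, without duality for `L^p`. -/
theorem lt_norm_eventually_of_weakConv (hp : 2 ≤ p) {b : ℕ → Lp E p (volume : Measure T3)}
    {a : Lp E p (volume : Measure T3)} (h : WeakConv (fun n => inclL2 hp (b n)) (inclL2 hp a))
    {r : ℝ} (hr : r < ‖a‖) : ∀ᶠ n in atTop, r < ‖b n‖ := by
  by_contra hc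
  rw [not_eventually] at hc
  have hle : ∀ v : Lp E p (volume : Measure T3),
      eLpNorm (inclL2 hp v) p volume = ENNReal.ofReal ‖v‖ := fun v => by
    rw [eLpNorm_congr_ae (coeFn_inclL2 hp v), Lp.norm_def, ENNReal.ofReal_toReal (Lp.memLp v).2.ne]
  have hmem := h.mem_of_frequently (convex_setOf_eLpNorm_le (p := p) (ENNReal.ofReal r))
    (isClosed_setOf_eLpNorm_le _) (hc.mono fun n hn => by
      rw [Set.mem_ofPred_eq, hle]
      exact ENNReal.ofReal_le_ofReal (not_lt.mp hn))
  rw [Set.mem_ofPred_eq, hle] at hmem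
  obtain ⟨n, hn⟩ := hc.exists
  exact absurd ((ENNReal.ofReal_le_ofReal_iff ((norm_nonneg _).trans (not_lt.mp hn))).mp hmem)
    (not_le.mpr hr)

end Inclusion

/-- Truncating at `a` turns the one-sided statement `a ≤ liminf x` into an actual limit, to which
continuous operations apply. -/
theorem tendsto_min_of_forall_lt {x : ℕ → ℝ} {a : ℝ} (h : ∀ r < a, ∀ᶠ n in atTop, r < x n) :
    Tendsto (fun n => min (x n) a) atTop (𝓝 a) := by
  rw [tendsto_order]
  refine ⟨fun r hr => ?_, fun r hr => Eventually.of_forall fun n => (min_le_right _ _).trans_lt hr⟩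
  filter_upwards [h r hr] with n hn using lt_min hn hr

theorem two_le_toReal {p : ℝ≥0∞} (hp : 2 ≤ p) (hp' : p ≠ ⊤) : 2 ≤ p.toReal := by
  simpa using ENNReal.toReal_mono hp' hp

theorem norm_rpow_toReal_eq_integral {E : Type*} [NormedAddCommGroup E] {p : ℝ≥0∞} (hp : 2 ≤ p)
    (hp' : p ≠ ⊤) (v : Lp E p (volume : Measure T3)) :
    ‖v‖ ^ p.toReal = ∫ x, ‖v x‖ ^ p.toReal := by
  have h0 : p ≠ 0 := (zero_lt_two.trans_le hp).ne'
  have hi : 0 ≤ ∫ x, ‖v x‖ ^ p.toReal := integral_nonneg fun _ => by positivity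
  rw [Lp.norm_def, (Lp.memLp v).eLpNorm_eq_integral_rpow_norm h0 hp',
    ENNReal.toReal_ofReal (by positivity), Real.rpow_inv_rpow hi (ENNReal.toReal_pos h0 hp').ne']

/-! ### Clarkson's inequality. -/

section Clarkson

variable {E : Type*} [NormedAddCommGroup E] [InnerProductSpace ℝ E]

/-- The parallelogram law combined with superadditivity and convexity of `t ↦ t ^ (P / 2)` on `[0,
∞)`. -/
theorem clarkson_norm {P : ℝ} (hP : 2 ≤ P) (a b : E) :
    ‖(2⁻¹ : ℝ) • (a + b)‖ ^ P + ‖(2⁻¹ : ℝ) • (a - b)‖ ^ P ≤ 2⁻¹ * (‖a‖ ^ P + ‖b‖ ^ P) := by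
  have hsq : ∀ x : E, ‖x‖ ^ P = (‖x‖ ^ 2) ^ (P / 2) := fun x => by
    rw [← Real.rpow_natCast, ← Real.rpow_mul (norm_nonneg _)]
    congr 1
    push_cast
    ring
  have hP2 : 1 ≤ P / 2 := by linarith
  have hsum : ‖(2⁻¹ : ℝ) • (a + b)‖ ^ 2 + ‖(2⁻¹ : ℝ) • (a - b)‖ ^ 2 =
      2⁻¹ * ‖a‖ ^ 2 + 2⁻¹ * ‖b‖ ^ 2 := by
    have := parallelogram_law_with_norm ℝ a b
    rw [norm_smul, norm_smul, mul_pow, mul_pow]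
    norm_num
    linarith
  rw [hsq, hsq, hsq a, hsq b]
  calc (‖(2⁻¹ : ℝ) • (a + b)‖ ^ 2) ^ (P / 2) + (‖(2⁻¹ : ℝ) • (a - b)‖ ^ 2) ^ (P / 2)
      ≤ (‖(2⁻¹ : ℝ) • (a + b)‖ ^ 2 + ‖(2⁻¹ : ℝ) • (a - b)‖ ^ 2) ^ (P / 2) := by
        have := NNReal.add_rpow_le_rpow_add (⟨‖(2⁻¹ : ℝ) • (a + b)‖ ^ 2, by positivity⟩ : NNReal)
          ⟨‖(2⁻¹ : ℝ) • (a - b)‖ ^ 2, by positivity⟩ hP2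
        exact_mod_cast this
    _ = (2⁻¹ * ‖a‖ ^ 2 + 2⁻¹ * ‖b‖ ^ 2) ^ (P / 2) := by rw [hsum]
    _ ≤ 2⁻¹ * (‖a‖ ^ 2) ^ (P / 2) + 2⁻¹ * (‖b‖ ^ 2) ^ (P / 2) :=
        (convexOn_rpow hP2).2 (sq_nonneg ‖a‖) (sq_nonneg ‖b‖) (by norm_num) (by norm_num)
          (by norm_num)
    _ = _ := by ring

variable {p : ℝ≥0∞} [Fact (1 ≤ p)]

theorem clarkson_Lp (hp : 2 ≤ p) (hp' : p ≠ ⊤) (a b : Lp E p (volume : Measure T3)) :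
    ‖(2⁻¹ : ℝ) • (a + b)‖ ^ p.toReal + ‖(2⁻¹ : ℝ) • (a - b)‖ ^ p.toReal ≤
      2⁻¹ * (‖a‖ ^ p.toReal + ‖b‖ ^ p.toReal) := by
  have h0 : p ≠ 0 := (zero_lt_two.trans_le hp).ne'
  have hint : ∀ v : Lp E p (volume : Measure T3), Integrable (fun x => ‖v x‖ ^ p.toReal) volume :=
    fun v => (Lp.memLp v).integrable_norm_rpow h0 hp'
  simp only [norm_rpow_toReal_eq_integral hp hp']
  rw [← integral_add (hint _) (hint _), ← integral_add (hint _) (hint _), ← integral_const_mul]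
  refine integral_mono_ae ((hint _).add (hint _)) (((hint _).add (hint _)).const_mul _) ?_
  filter_upwards [Lp.coeFn_smul (2⁻¹ : ℝ) (a + b), Lp.coeFn_smul (2⁻¹ : ℝ) (a - b),
    Lp.coeFn_add a b, Lp.coeFn_sub a b] with x h1 h2 h3 h4
  rw [h1, h2, Pi.smul_apply, Pi.smul_apply, h3, h4]
  exact clarkson_norm (two_le_toReal hp hp') (a x) (b x)

theorem Sobolev.norm_rpow {k : ℕ} (hp : 2 ≤ p) (hp' : p ≠ ⊤) (v : Sobolev k p E) :
    ‖v‖ ^ p.toReal = ∑ α, ‖v.1 α‖ ^ p.toReal := by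
  have h0 : 0 < p.toReal := by linarith [two_le_toReal hp hp']
  rw [Submodule.coe_norm, PiLp.norm_eq_sum h0, ← Real.rpow_mul (by positivity),
    one_div_mul_cancel h0.ne', Real.rpow_one]

theorem clarkson_Sobolev {k : ℕ} (hp : 2 ≤ p) (hp' : p ≠ ⊤) (a b : Sobolev k p E) :
    ‖(2⁻¹ : ℝ) • (a + b)‖ ^ p.toReal + ‖(2⁻¹ : ℝ) • (a - b)‖ ^ p.toReal ≤
      2⁻¹ * (‖a‖ ^ p.toReal + ‖b‖ ^ p.toReal) := by
  simp only [Sobolev.norm_rpow hp hp']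
  rw [← Finset.sum_add_distrib, ← Finset.sum_add_distrib, Finset.mul_sum]
  exact Finset.sum_le_sum fun α _ => clarkson_Lp hp hp' (a.1 α) (b.1 α)

end Clarkson

/-! ### Weak and strong convergence in Sobolev spaces. -/

section SobolevWeak

variable {E : Type*} [NormedAddCommGroup E] [InnerProductSpace ℝ E] {p : ℝ≥0∞} [Fact (1 ≤ p)]
  {k : ℕ}

/-- The `L²` class of a Sobolev function. -/
noncomputable def Sobolev.toL2 (hp : 2 ≤ p) :
    Sobolev k p E →L[ℝ] Lp E 2 (volume : Measure T3) :=
  (inclL2 hp).comp ((PiLp.proj p (fun _ : MultiIdx k => Lp E p (volume : Measure T3))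
    (MultiIdx.zero k)).comp (Sobolev k p E).subtypeL)

theorem Sobolev.toL2_apply (hp : 2 ≤ p) (v : Sobolev k p E) :
    Sobolev.toL2 hp v = inclL2 hp (v.1 (MultiIdx.zero k)) := rfl

theorem Sobolev.coeFn_toL2 (hp : 2 ≤ p) (v : Sobolev k p E) :
    (Sobolev.toL2 hp v : T3 → E) =ᵐ[volume] Sobolev.fn v :=
  coeFn_inclL2 hp _

variable [CompleteSpace E]

theorem Sobolev.inner_testL2 (hp : 2 ≤ p) (v : Sobolev k p E) (α : MultiIdx k) {φ : T3 → ℝ}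
    (hφ : T3.Smooth φ) (e : E) :
    inner ℝ (testL2 hφ.continuous e) (inclL2 hp (v.1 α)) = (-1) ^ (∑ j, (α.1 j : ℕ)) *
      inner ℝ (testL2 (hφ.multiDeriv fun j => (α.1 j : ℕ)).continuous e) (Sobolev.toL2 hp v) := by
  rw [inner_testL2_eq_inner_integral, inner_testL2_eq_inner_integral]
  have h1 : ∀ (ψ : T3 → ℝ) (w : Lp E p (volume : Measure T3)),
      ∫ x, ψ x • inclL2 hp w x = ∫ x, ψ x • w x := fun ψ w => integral_congr_ae (by
    filter_upwards [coeFn_inclL2 hp w] with x hx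
    rw [hx])
  rw [Sobolev.toL2_apply, h1, h1, v.2 α φ hφ, inner_smul_right, ← mul_assoc, ← mul_pow]
  norm_num

variable [SecondCountableTopology E]

/-- Against a smooth test function the derivative moves onto that function, so weak convergence of
the functions passes to every weak derivative. The norm bound extends this from test functions to
all of `L²`. -/
theorem Sobolev.weakConv_apply (hp : 2 ≤ p) {b : ℕ → Sobolev k p E} {a : Sobolev k p E} {C : ℝ}
    (hC : ∀ᶠ n in atTop, ‖b n‖ ≤ C)
    (h : WeakConv (fun n => Sobolev.toL2 hp (b n)) (Sobolev.toL2 hp a)) (α : MultiIdx k) :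
    WeakConv (fun n => inclL2 hp ((b n).1 α)) (inclL2 hp (a.1 α)) := by
  have hbd : ∀ᶠ n in atTop, ‖inclL2 hp ((b n).1 α)‖ ≤ ‖inclL2 (E := E) hp‖ * C := by
    filter_upwards [hC] with n hn
    refine (ContinuousLinearMap.le_opNorm _ _).trans ?_
    gcongr
    exact (Sobolev.norm_apply_le _ α).trans hn
  have ht : ∀ d ∈ {g : Lp E 2 (volume : Measure T3) |
      ∃ (φ : T3 → ℝ) (hφ : T3.Smooth φ) (e : E), testL2 hφ.continuous e = g},
      Tendsto (fun n => inner ℝ d (inclL2 hp ((b n).1 α))) atTop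
        (𝓝 (inner ℝ d (inclL2 hp (a.1 α)))) := by
    rintro _ ⟨φ, hφ, e, rfl⟩
    have := (h (innerSL ℝ (testL2 (hφ.multiDeriv fun j => (α.1 j : ℕ)).continuous e))).const_mul
      ((-1 : ℝ) ^ (∑ j, (α.1 j : ℕ)))
    simp only [innerSL_apply_apply] at this
    rw [Sobolev.inner_testL2 hp a α hφ e]
    refine this.congr fun n => ?_
    rw [Sobolev.inner_testL2 hp (b n) α hφ e]
  exact weakConv_of_tendsto_inner fun g =>
    tendsto_inner_of_forall_mem hbd dense_span_testL2 ht g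

theorem Sobolev.lt_norm_eventually (hp : 2 ≤ p) (hp' : p ≠ ⊤) {b : ℕ → Sobolev k p E}
    {a : Sobolev k p E} {C : ℝ} (hC : ∀ᶠ n in atTop, ‖b n‖ ≤ C)
    (h : WeakConv (fun n => Sobolev.toL2 hp (b n)) (Sobolev.toL2 hp a)) {r : ℝ} (hr : r < ‖a‖) :
    ∀ᶠ n in atTop, r < ‖b n‖ := by
  have h0 : 0 < p.toReal := by linarith [two_le_toReal hp hp']
  have h1 : ∀ α, Tendsto (fun n => min ‖(b n).1 α‖ ‖a.1 α‖) atTop (𝓝 ‖a.1 α‖) := fun α =>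
    tendsto_min_of_forall_lt fun r hr =>
      lt_norm_eventually_of_weakConv hp (Sobolev.weakConv_apply hp hC h α) hr
  have h2 : Tendsto (fun n => (∑ α, (min ‖(b n).1 α‖ ‖a.1 α‖) ^ p.toReal) ^ (1 / p.toReal)) atTop
      (𝓝 ((∑ α, ‖a.1 α‖ ^ p.toReal) ^ (1 / p.toReal))) :=
    (tendsto_finsetSum _ fun α _ => (h1 α).rpow_const (Or.inr h0.le)).rpow_const
      (Or.inr (by positivity))
  rw [← PiLp.norm_eq_sum h0] at h2
  filter_upwards [h2.eventually (lt_mem_nhds hr)] with n hn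
  refine hn.trans_le ?_
  rw [Submodule.coe_norm, PiLp.norm_eq_sum h0]
  gcongr with α
  exact min_le_left _ _

/-- Weak convergence together with convergence of the norms implies strong convergence. -/
theorem Sobolev.tendsto_of_weakConv (hp : 2 ≤ p) (hp' : p ≠ ⊤) {b : ℕ → Sobolev k p E}
    {a : Sobolev k p E} (hn : Tendsto (fun n => ‖b n‖) atTop (𝓝 ‖a‖))
    (h : WeakConv (fun n => Sobolev.toL2 hp (b n)) (Sobolev.toL2 hp a)) :
    Tendsto b atTop (𝓝 a) := by
  have h0 : 0 < p.toReal := by linarith [two_le_toReal hp hp']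
  -- The midpoints also converge weakly to `a`, so their norms cannot drop below `‖a‖` in the limit.
  -- Clarkson's inequality then leaves no room for `‖a - b n‖`.
  set c : ℕ → Sobolev k p E := fun n => (2⁻¹ : ℝ) • (a + b n)
  have hc : WeakConv (fun n => Sobolev.toL2 hp (c n)) (Sobolev.toL2 hp a) := by
    have h1 := ((WeakConv.const (Sobolev.toL2 hp a)).add h).const_smul 2⁻¹
    have h2 : (2⁻¹ : ℝ) • (Sobolev.toL2 hp a + Sobolev.toL2 hp a) = Sobolev.toL2 hp a := by
      rw [← two_smul ℝ, smul_smul, inv_mul_cancel₀ two_ne_zero, one_smul]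
    rw [h2] at h1
    simpa only [c, map_smul, map_add] using h1
  have hcC : ∀ᶠ n in atTop, ‖c n‖ ≤ ‖a‖ + 1 := by
    filter_upwards [hn.eventually (gt_mem_nhds (lt_add_one ‖a‖))] with n hn
    simp only [c]
    rw [norm_smul, norm_inv, Real.norm_two]
    have := norm_add_le a (b n)
    linarith [norm_nonneg a]
  have hm := tendsto_min_of_forall_lt (x := fun n => ‖c n‖) (a := ‖a‖)
    fun r hr => Sobolev.lt_norm_eventually hp hp' hcC hc hr
  have hlim : Tendsto (fun n => 2⁻¹ * (‖a‖ ^ p.toReal + ‖b n‖ ^ p.toReal) -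
      (min ‖c n‖ ‖a‖) ^ p.toReal) atTop (𝓝 0) := by
    have := ((tendsto_const_nhds (x := ‖a‖ ^ p.toReal)).add
      (hn.rpow_const (p := p.toReal) (Or.inr h0.le))).const_mul 2⁻¹ |>.sub
      (hm.rpow_const (p := p.toReal) (Or.inr h0.le))
    convert this using 2
    ring
  have hd : Tendsto (fun n => ‖(2⁻¹ : ℝ) • (a - b n)‖ ^ p.toReal) atTop (𝓝 0) := by
    refine squeeze_zero (fun n => by positivity) (fun n => ?_) hlim
    have h1 := clarkson_Sobolev hp hp' a (b n)
    have h2 : (min ‖c n‖ ‖a‖) ^ p.toReal ≤ ‖c n‖ ^ p.toReal := by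
      gcongr
      exact min_le_left _ _
    simp only [c] at h2 ⊢
    linarith
  have hd' : Tendsto (fun n => ‖(2⁻¹ : ℝ) • (a - b n)‖) atTop (𝓝 0) := by
    have := hd.rpow_const (p := p.toReal⁻¹) (Or.inr (by positivity))
    rw [Real.zero_rpow (inv_ne_zero h0.ne')] at this
    refine this.congr fun n => ?_
    rw [Real.rpow_rpow_inv (norm_nonneg _) h0.ne']
  rw [tendsto_iff_norm_sub_tendsto_zero]
  have := hd'.const_mul 2
  rw [mul_zero] at this
  refine this.congr fun n => ?_
  rw [norm_smul, norm_sub_rev, norm_inv, Real.norm_two, mul_inv_cancel_left₀ two_ne_zero]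

/-- Uniqueness of weak derivatives, obtained from `Sobolev.weakConv_apply` for a constant sequence.
-/
theorem Sobolev.toL2_injective (hp : 2 ≤ p) :
    Function.Injective (Sobolev.toL2 hp : Sobolev k p E → Lp E 2 (volume : Measure T3)) := by
  intro v w h
  refine Subtype.ext (PiLp.ext fun α => inclL2_injective hp ?_)
  have h1 : WeakConv (fun _ : ℕ => Sobolev.toL2 hp w) (Sobolev.toL2 hp v) := by
    rw [h]; exact WeakConv.const _
  exact (Sobolev.weakConv_apply hp (C := ‖w‖) (by simp) h1 α).eq_of_const

end SobolevWeak

/-! ### Completeness and separability of Sobolev spaces. -/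

section Completeness

variable {E : Type*} [NormedAddCommGroup E] [NormedSpace ℝ E] {p : ℝ≥0∞} [Fact (1 ≤ p)] {k : ℕ}

theorem continuous_integral_smul_Lp {φ : T3 → ℝ} (hφ : Continuous φ) :
    Continuous fun v : Lp E p (volume : Measure T3) => ∫ x, φ x • v x := by
  obtain ⟨C, hC⟩ := isCompact_univ.exists_bound_of_continuousOn (f := φ) hφ.continuousOn
  have hp1 : (1 : ℝ≥0∞) ≤ p := Fact.out
  have hC0 : 0 ≤ C := (norm_nonneg _).trans (hC 0 trivial)
  have hpr : 0 ≤ 1 / (1 : ℝ≥0∞).toReal - 1 / p.toReal := by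
    rcases eq_or_ne p ⊤ with rfl | hp'
    · simp
    · have : (1 : ℝ≥0∞).toReal ≤ p.toReal := ENNReal.toReal_mono hp' hp1
      exact sub_nonneg.mpr (one_div_le_one_div_of_le (by norm_num) this)
  refine (LipschitzWith.of_dist_le_mul (K := (C * ((volume (Set.univ : Set T3)) ^
    (1 / (1 : ℝ≥0∞).toReal - 1 / p.toReal)).toReal).toNNReal) fun v w => ?_).continuous
  have hint : ∀ v : Lp E p (volume : Measure T3), Integrable v volume := fun v =>
    (Lp.memLp v).integrable hp1
  have h1 : ∫ x, ‖(v - w) x‖ ≤ ‖v - w‖ * ((volume (Set.univ : Set T3)) ^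
      (1 / (1 : ℝ≥0∞).toReal - 1 / p.toReal)).toReal := by
    rw [integral_norm_eq_lintegral_enorm (hint _).aestronglyMeasurable,
      ← eLpNorm_one_eq_lintegral_enorm, Lp.norm_def, ← ENNReal.toReal_mul]
    exact ENNReal.toReal_mono (ENNReal.mul_ne_top (Lp.memLp _).2.ne
      (ENNReal.rpow_ne_top_of_nonneg hpr (measure_ne_top _ _)))
      (eLpNorm_le_eLpNorm_mul_rpow_measure_univ hp1 (hint _).aestronglyMeasurable)
  rw [dist_eq_norm, dist_eq_norm, Real.coe_toNNReal _ (by positivity),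
    ← integral_sub (integrable_smul_Lp hφ v) (integrable_smul_Lp hφ w)]
  calc ‖∫ x, (φ x • v x - φ x • w x)‖ ≤ ∫ x, C * ‖(v - w) x‖ := by
        refine norm_integral_le_of_norm_le ((hint _).norm.const_mul _) ?_
        filter_upwards [Lp.coeFn_sub v w] with x hx
        rw [hx, ← smul_sub, norm_smul]
        gcongr
        · exact hC x trivial
        · rfl
    _ = C * ∫ x, ‖(v - w) x‖ := integral_const_mul _ _
    _ ≤ C * (‖v - w‖ * _) := by gcongr
    _ = _ := by ring

theorem Sobolev.isClosed : IsClosed (Sobolev k p E : Set (PiLp p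
    (fun _ : MultiIdx k => Lp E p (volume : Measure T3)))) := by
  have : (Sobolev k p E : Set (PiLp p (fun _ : MultiIdx k => Lp E p (volume : Measure T3)))) =
      ⋂ (α : MultiIdx k) (φ : T3 → ℝ) (_ : T3.Smooth φ),
        {V | ∫ x, T3.multiDeriv (fun j => (α.1 j : ℕ)) φ x • V (MultiIdx.zero k) x =
          (-1 : ℝ) ^ (∑ j, (α.1 j : ℕ)) • ∫ x, φ x • V α x} := by
    ext V
    simp only [Set.mem_iInter, Set.mem_ofPred_eq]
    rfl
  rw [this]
  refine isClosed_iInter fun α => isClosed_iInter fun φ => isClosed_iInter fun hφ =>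
    isClosed_eq ?_ ?_
  · exact (continuous_integral_smul_Lp (hφ.multiDeriv _).continuous).comp
      (PiLp.continuous_apply p _ _)
  · exact ((continuous_integral_smul_Lp hφ.continuous).comp
      (PiLp.continuous_apply p _ _)).const_smul _

instance Sobolev.completeSpace [CompleteSpace E] : CompleteSpace (Sobolev k p E) :=
  Sobolev.isClosed.completeSpace_coe

theorem Sobolev.secondCountableTopology [SecondCountableTopology E] (hp : p ≠ ⊤) :
    SecondCountableTopology (Sobolev k p E) := by
  have : Fact (p ≠ ⊤) := ⟨hp⟩
  have h1 : SecondCountableTopology (Lp E p (volume : Measure T3)) := inferInstance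
  have h2 : SecondCountableTopology (PiLp p (fun _ : MultiIdx k => Lp E p (volume : Measure T3))) :=
    inferInstance
  exact TopologicalSpace.Subtype.secondCountableTopology _

end Completeness

/-! ### The sup norm of the reciprocal. -/

section InvCNorm

/-- The infimum runs over at most one function: two continuous functions equal almost everywhere
coincide, since nonempty open sets have positive measure. -/
theorem invCNorm_eq_of_ae {f : T3 → ℝ} {w : C(T3, ℝ)} (h : f =ᵐ[volume] w) :
    invCNorm f = ⨆ x, ‖w x‖ₑ⁻¹ := by
  refine le_antisymm (iInf₂_le w h) (le_iInf₂ fun w' h' => ?_)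
  have : (w : T3 → ℝ) = w' :=
    (Continuous.ae_eq_iff_eq volume w.continuous w'.continuous).mp (h.symm.trans h')
  rw [this]

/-- An infimum over the empty set is `⊤`. Membership in `X⁺` therefore provides the continuous
representatives that the Morrey bound presupposes. -/
theorem exists_ae_eq_of_invCNorm_lt_top {f : T3 → ℝ} (h : invCNorm f < ⊤) :
    ∃ w : C(T3, ℝ), f =ᵐ[volume] w := by
  by_contra hc
  push Not at hc
  refine h.ne (iInf₂_eq_top.mpr fun w hw => absurd hw (hc w))

theorem invCNorm_le_ofReal_iff_of_ae {f : T3 → ℝ} {w : C(T3, ℝ)} (h : f =ᵐ[volume] w) {r : ℝ}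
    (hr : 0 < r) : invCNorm f ≤ ENNReal.ofReal r ↔ ∀ x, r⁻¹ ≤ |w x| := by
  rw [invCNorm_eq_of_ae h, iSup_le_iff]
  refine forall_congr' fun x => ?_
  rw [ENNReal.inv_le_iff_inv_le, ← ENNReal.ofReal_inv_of_pos hr, Real.enorm_eq_ofReal_abs,
    ENNReal.ofReal_le_ofReal_iff (abs_nonneg _)]

theorem invCNorm_pos (f : T3 → ℝ) : 0 < invCNorm f := by
  rcases eq_or_ne (invCNorm f) ⊤ with h | h
  · rw [h]; exact ENNReal.zero_lt_top
  · obtain ⟨w, hw⟩ := exists_ae_eq_of_invCNorm_lt_top (lt_top_iff_ne_top.mpr h)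
    rw [invCNorm_eq_of_ae hw]
    exact (ENNReal.inv_pos.mpr enorm_ne_top).trans_le (le_iSup (fun x => ‖w x‖ₑ⁻¹) (0 : T3))

theorem invCNorm_of_ae_zero {f : T3 → ℝ} (h : f =ᵐ[volume] 0) : invCNorm f = ⊤ := by
  rw [invCNorm_eq_of_ae (w := (0 : C(T3, ℝ))) h]
  simp

end InvCNorm

/-! ### Convergence of continuous representatives and of their reciprocals. -/

section Representative

variable {k : ℕ} {p : ℝ≥0∞} [Fact (1 ≤ p)]

theorem Sobolev.fn_sub_ae_eq {v v' : Sobolev k p ℝ} {w w' : C(T3, ℝ)}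
    (h : Sobolev.fn v =ᵐ[volume] w) (h' : Sobolev.fn v' =ᵐ[volume] w') :
    Sobolev.fn (v - v') =ᵐ[volume] (w - w' : C(T3, ℝ)) := by
  have h1 : Sobolev.fn (v - v') =ᵐ[volume] Sobolev.fn v - Sobolev.fn v' :=
    Lp.coeFn_sub (v.1 (MultiIdx.zero k)) (v'.1 (MultiIdx.zero k))
  exact h1.trans (h.sub h')

theorem Sobolev.exists_dist_le (hk : k ≤ 2) (hkp : 3 / p.toReal < k) :
    ∃ C : ℝ, 0 < C ∧ ∀ (v v' : Sobolev k p ℝ) (w w' : C(T3, ℝ)), Sobolev.fn v =ᵐ[volume] w →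
      Sobolev.fn v' =ᵐ[volume] w' → dist w w' ≤ C * dist v v' := by
  obtain ⟨C, hC0, hC⟩ := Sobolev.exists_abs_le hk p hkp
  refine ⟨C, hC0, fun v v' w w' h h' => ?_⟩
  rw [dist_eq_norm, dist_eq_norm, ContinuousMap.norm_le _ (by positivity)]
  exact hC _ _ (Sobolev.fn_sub_ae_eq h h')

theorem Sobolev.tendsto_representative (hk : k ≤ 2) (hkp : 3 / p.toReal < k)
    {b : ℕ → Sobolev k p ℝ} {a : Sobolev k p ℝ} (hba : Tendsto b atTop (𝓝 a))
    {w : ℕ → C(T3, ℝ)} {z : C(T3, ℝ)} (hw : ∀ n, Sobolev.fn (b n) =ᵐ[volume] w n)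
    (hz : Sobolev.fn a =ᵐ[volume] z) : Tendsto w atTop (𝓝 z) := by
  obtain ⟨C, hC0, hC⟩ := Sobolev.exists_dist_le (p := p) hk hkp
  rw [tendsto_iff_dist_tendsto_zero] at hba ⊢
  have := hba.const_mul C
  rw [mul_zero] at this
  exact squeeze_zero (fun _ => dist_nonneg) (fun n => hC _ _ _ _ (hw n) hz) this

theorem Sobolev.exists_representative_of_tendsto (hk : k ≤ 2) (hkp : 3 / p.toReal < k)
    {b : ℕ → Sobolev k p ℝ} {a : Sobolev k p ℝ} (hba : Tendsto b atTop (𝓝 a))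
    {w : ℕ → C(T3, ℝ)} (hw : ∀ n, Sobolev.fn (b n) =ᵐ[volume] w n) :
    ∃ z : C(T3, ℝ), Sobolev.fn a =ᵐ[volume] z := by
  obtain ⟨C, hC0, hC⟩ := Sobolev.exists_dist_le (p := p) hk hkp
  have hcs : CauchySeq w := by
    have hb := hba.cauchySeq
    rw [Metric.cauchySeq_iff] at hb ⊢
    intro ε hε
    obtain ⟨N, hN⟩ := hb (ε / C) (by positivity)
    refine ⟨N, fun m hm n hn => ?_⟩
    calc dist (w m) (w n) ≤ C * dist (b m) (b n) := hC _ _ _ _ (hw m) (hw n)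
      _ < C * (ε / C) := by gcongr; exact hN m hm n hn
      _ = ε := by field_simp
  obtain ⟨z, hz⟩ := cauchySeq_tendsto_of_complete hcs
  refine ⟨z, ?_⟩
  -- The uniform limit `z` is identified with `a` by uniqueness of limits in `L^p`.
  have h1 : Tendsto (fun n => ContinuousMap.toLp (E := ℝ) p volume ℝ (w n)) atTop
      (𝓝 (ContinuousMap.toLp (E := ℝ) p volume ℝ z)) :=
    ((ContinuousMap.toLp (E := ℝ) p (volume : Measure T3) ℝ).continuous.tendsto z).comp hz
  have h2 : ∀ n, ContinuousMap.toLp (E := ℝ) p volume ℝ (w n) = (b n).1 (MultiIdx.zero k) :=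
    fun n => Lp.ext ((ContinuousMap.coeFn_toLp (p := p) (𝕜 := ℝ) volume (w n)).trans (hw n).symm)
  have h3 : Tendsto (fun n => (b n).1 (MultiIdx.zero k)) atTop (𝓝 (a.1 (MultiIdx.zero k))) :=
    ((PiLp.continuous_apply p _ (MultiIdx.zero k)).comp continuous_subtype_val).tendsto a
      |>.comp hba
  simp only [h2] at h1
  have h4 := tendsto_nhds_unique h3 h1
  have h5 := ContinuousMap.coeFn_toLp (p := p) (𝕜 := ℝ) (volume : Measure T3) z
  rw [← h4] at h5
  exact h5

theorem Sobolev.invCNorm_le_of_tendsto (hk : k ≤ 2) (hkp : 3 / p.toReal < k)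
    {b : ℕ → Sobolev k p ℝ} {a : Sobolev k p ℝ} (hba : Tendsto b atTop (𝓝 a)) {r : ℝ} (hr : 0 < r)
    (h : ∀ n, invCNorm (Sobolev.fn (b n)) ≤ ENNReal.ofReal r) :
    invCNorm (Sobolev.fn a) ≤ ENNReal.ofReal r := by
  choose w hw using fun n =>
    exists_ae_eq_of_invCNorm_lt_top ((h n).trans_lt ENNReal.ofReal_lt_top)
  obtain ⟨z, hz⟩ := Sobolev.exists_representative_of_tendsto hk hkp hba hw
  have hwz := Sobolev.tendsto_representative hk hkp hba hw hz
  rw [invCNorm_le_ofReal_iff_of_ae hz hr]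
  intro x
  have hx : Tendsto (fun n => |w n x|) atTop (𝓝 |z x|) :=
    (((continuous_eval_const x).tendsto z).comp hwz).abs
  exact ge_of_tendsto' hx fun n => (invCNorm_le_ofReal_iff_of_ae (hw n) hr).mp (h n) x

/-- Since `|z| ≥ s⁻¹` for the representative `z` of `a`, uniform closeness within `s⁻¹ - r⁻¹` keeps
the nearby representatives above `r⁻¹` in modulus. -/
theorem Sobolev.eventually_invCNorm_le (hk : k ≤ 2) (hkp : 3 / p.toReal < k)
    {b : ℕ → Sobolev k p ℝ} {a : Sobolev k p ℝ} (hba : Tendsto b atTop (𝓝 a)) {r : ℝ}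
    (hb : ∀ᶠ n in atTop, invCNorm (Sobolev.fn (b n)) < ⊤)
    (ha : invCNorm (Sobolev.fn a) < ENNReal.ofReal r) :
    ∀ᶠ n in atTop, invCNorm (Sobolev.fn (b n)) ≤ ENNReal.ofReal r := by
  obtain ⟨C, hC0, hC⟩ := Sobolev.exists_dist_le (p := p) hk hkp
  obtain ⟨z, hz⟩ := exists_ae_eq_of_invCNorm_lt_top (ha.trans ENNReal.ofReal_lt_top)
  set s := (invCNorm (Sobolev.fn a)).toReal
  have hs0 : 0 < s := ENNReal.toReal_pos (invCNorm_pos _).ne' (ha.trans ENNReal.ofReal_lt_top).ne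
  have hsa : ENNReal.ofReal s = invCNorm (Sobolev.fn a) :=
    ENNReal.ofReal_toReal (ha.trans ENNReal.ofReal_lt_top).ne
  have hsr : s < r := by
    rw [← hsa] at ha
    exact (ENNReal.ofReal_lt_ofReal_iff_of_nonneg hs0.le).mp ha
  have hr : 0 < r := hs0.trans hsr
  have hzs := (invCNorm_le_ofReal_iff_of_ae hz hs0).mp hsa.ge
  have hgap : 0 < s⁻¹ - r⁻¹ := sub_pos.mpr (inv_strictAnti₀ hs0 hsr)
  filter_upwards [hb, (Metric.tendsto_nhds.mp hba) ((s⁻¹ - r⁻¹) / C) (by positivity)] with n hn hn'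
  obtain ⟨w, hw⟩ := exists_ae_eq_of_invCNorm_lt_top hn
  rw [invCNorm_le_ofReal_iff_of_ae hw hr]
  intro x
  have h1 : dist (w x) (z x) ≤ s⁻¹ - r⁻¹ := by
    refine (ContinuousMap.dist_apply_le_dist x).trans ((hC _ _ _ _ hw hz).trans ?_)
    calc C * dist (b n) a ≤ C * ((s⁻¹ - r⁻¹) / C) := by gcongr
      _ = s⁻¹ - r⁻¹ := by field_simp
  have h2 := hzs x
  rw [Real.dist_eq] at h1
  have h3 := abs_sub_abs_le_abs_sub (z x) (w x)
  rw [abs_sub_comm] at h3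
  linarith

theorem isClosed_setOf_ae_le (c : ℝ) :
    IsClosed {g : Lp ℝ 2 (volume : Measure T3) | ∀ᵐ x, c ≤ g x} := by
  have : {g : Lp ℝ 2 (volume : Measure T3) | ∀ᵐ x, c ≤ g x} =
      Set.Ici (Lp.const 2 (volume : Measure T3) c) := by
    ext g
    rw [Set.mem_Ici, ← Lp.coeFn_le, Set.mem_ofPred_eq]
    have hc := Lp.coeFn_const 2 (volume : Measure T3) c
    constructor
    · intro h
      filter_upwards [h, hc] with x hx hx'
      rw [hx']; exact hx
    · intro h
      filter_upwards [h, hc] with x hx hx'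
      rw [hx'] at hx; exact hx
  rw [this]
  exact isClosed_Ici

theorem convex_setOf_ae_le (c : ℝ) :
    Convex ℝ {g : Lp ℝ 2 (volume : Measure T3) | ∀ᵐ x, c ≤ g x} := by
  intro g hg g' hg' a b ha hb hab
  rw [Set.mem_ofPred_eq] at hg hg' ⊢
  filter_upwards [hg, hg', Lp.coeFn_add (a • g) (b • g'), Lp.coeFn_smul a g, Lp.coeFn_smul b g']
    with x h1 h2 h3 h4 h5
  rw [h3, Pi.add_apply, h4, h5, Pi.smul_apply, Pi.smul_apply, smul_eq_mul, smul_eq_mul]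
  calc c = a * c + b * c := by rw [← add_mul, hab, one_mul]
    _ ≤ a * g x + b * g' x := by gcongr

theorem forall_le_of_ae_le {z : C(T3, ℝ)} {c : ℝ} (h : ∀ᵐ x, c ≤ z x) (x : T3) : c ≤ z x := by
  by_contra hc
  have ho : IsOpen {x | z x < c} := isOpen_lt z.continuous continuous_const
  have h0 : (volume : Measure T3) {x | z x < c} = 0 := by
    simpa [ae_iff] using h
  exact (ho.measure_pos volume ⟨x, not_le.mp hc⟩).ne' h0

/-- The torus is connected, so a continuous function bounded away from zero has constant sign. -/
theorem forall_le_or_forall_le_neg {w : C(T3, ℝ)} {c : ℝ} (hc : 0 < c) (h : ∀ x, c ≤ |w x|) :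
    (∀ x, c ≤ w x) ∨ ∀ x, c ≤ -w x := by
  by_contra hcon
  push Not at hcon
  obtain ⟨⟨x, hx⟩, y, hy⟩ := hcon
  have hx' : w x ≤ 0 := by
    rcases le_abs.mp (h x) with h1 | h1 <;> linarith
  have hy' : 0 ≤ w y := by
    rcases le_abs.mp (h y) with h1 | h1 <;> linarith
  obtain ⟨t, ht⟩ := mem_range_of_exists_le_of_exists_ge w.continuous ⟨x, hx'⟩ ⟨y, hy'⟩
  have := h t
  rw [ht, abs_zero] at this
  linarith

/-- The condition `|w| ≥ r⁻¹` is not convex, but fixing the sign makes it a closed convex condition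
in `L²`, stable under weak limits. Finiteness along the sequence matters because `toReal` sends `⊤`
to `0`. -/
theorem Sobolev.lt_invCNorm_eventually (hp : 2 ≤ p)
    {b : ℕ → Sobolev k p ℝ} {a : Sobolev k p ℝ}
    (h : WeakConv (fun n => Sobolev.toL2 hp (b n)) (Sobolev.toL2 hp a))
    (hb : ∀ᶠ n in atTop, invCNorm (Sobolev.fn (b n)) < ⊤) (ha : invCNorm (Sobolev.fn a) < ⊤)
    {r : ℝ} (hr : r < (invCNorm (Sobolev.fn a)).toReal) :
    ∀ᶠ n in atTop, r < (invCNorm (Sobolev.fn (b n))).toReal := by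
  by_contra hcon
  rw [not_eventually] at hcon
  have hfr := hcon.and_eventually hb
  have hr0 : 0 < r := by
    obtain ⟨n, hn, hn'⟩ := hfr.exists
    exact (ENNReal.toReal_pos (invCNorm_pos _).ne' hn'.ne).trans_le (not_lt.mp hn)
  have hri : 0 < r⁻¹ := inv_pos.mpr hr0
  obtain ⟨z, hz⟩ := exists_ae_eq_of_invCNorm_lt_top ha
  have hL : ∀ v : Sobolev k p ℝ, ∀ w : C(T3, ℝ), Sobolev.fn v =ᵐ[volume] w →
      (Sobolev.toL2 hp v : T3 → ℝ) =ᵐ[volume] w := fun v w hw => (Sobolev.coeFn_toL2 hp v).trans hw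
  have hL' : ∀ v : Sobolev k p ℝ, ∀ w : C(T3, ℝ), Sobolev.fn v =ᵐ[volume] w →
      (((-1 : ℝ) • Sobolev.toL2 hp v : Lp ℝ 2 (volume : Measure T3)) : T3 → ℝ) =ᵐ[volume]
        fun x => -w x := fun v w hw => by
    filter_upwards [Lp.coeFn_smul (-1 : ℝ) (Sobolev.toL2 hp v), hL v w hw] with x h1 h2
    rw [h1, Pi.smul_apply, h2, smul_eq_mul, neg_one_mul]
  have hz' : ∀ x, r⁻¹ ≤ |z x| := by
    -- One of the two signs occurs infinitely often.
    have hfr' : ∃ᶠ n in atTop, (∀ᵐ x, r⁻¹ ≤ Sobolev.toL2 hp (b n) x) ∨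
        ∀ᵐ x, r⁻¹ ≤ ((-1 : ℝ) • Sobolev.toL2 hp (b n) : Lp ℝ 2 (volume : Measure T3)) x := by
      refine hfr.mono fun n ⟨hn, hn'⟩ => ?_
      obtain ⟨w, hw⟩ := exists_ae_eq_of_invCNorm_lt_top hn'
      have hle : invCNorm (Sobolev.fn (b n)) ≤ ENNReal.ofReal r :=
        (ENNReal.le_ofReal_iff_toReal_le hn'.ne hr0.le).mpr (not_lt.mp hn)
      rcases forall_le_or_forall_le_neg hri ((invCNorm_le_ofReal_iff_of_ae hw hr0).mp hle)
        with h1 | h1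
      · left
        filter_upwards [hL _ _ hw] with x hx
        rw [hx]; exact h1 x
      · right
        filter_upwards [hL' _ _ hw] with x hx
        rw [hx]; exact h1 x
    rcases frequently_or_distrib.mp hfr' with h1 | h1
    · have hm := h.mem_of_frequently (convex_setOf_ae_le r⁻¹) (isClosed_setOf_ae_le r⁻¹) h1
      have hm' : ∀ᵐ x, r⁻¹ ≤ z x := by
        filter_upwards [hm, hL _ _ hz] with x h1 h2
        rwa [← h2]
      exact fun x => (forall_le_of_ae_le hm' x).trans (le_abs_self _)
    · have hm := (h.const_smul (-1)).mem_of_frequently (convex_setOf_ae_le r⁻¹)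
        (isClosed_setOf_ae_le r⁻¹) h1
      have hm' : ∀ᵐ x, r⁻¹ ≤ (-z) x := by
        filter_upwards [hm, hL' _ _ hz] with x h1 h2
        rw [h2] at h1
        exact h1
      exact fun x => (forall_le_of_ae_le hm' x).trans (neg_le_abs _)
  have hle := (invCNorm_le_ofReal_iff_of_ae hz hr0).mpr hz'
  exact absurd ((ENNReal.le_ofReal_iff_toReal_le ha.ne hr0.le).mp hle) (not_le.mpr hr)

theorem Sobolev.weakConv_toL2_of_tendsto (hp : 2 ≤ p) {E : Type*} [NormedAddCommGroup E]
    [InnerProductSpace ℝ E] {b : ℕ → Sobolev k p E} {a : Sobolev k p E}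
    (hba : Tendsto b atTop (𝓝 a)) :
    WeakConv (fun n => Sobolev.toL2 hp (b n)) (Sobolev.toL2 hp a) := fun f =>
  ((f.continuous.comp (Sobolev.toL2 hp).continuous).tendsto a).comp hba

/-- The lower bound comes from weak convergence, the upper bound from uniform convergence of the
representatives. -/
theorem Sobolev.tendsto_invCNorm (hp : 2 ≤ p) (hk : k ≤ 2) (hkp : 3 / p.toReal < k)
    {b : ℕ → Sobolev k p ℝ} {a : Sobolev k p ℝ} (hba : Tendsto b atTop (𝓝 a))
    (hb : ∀ᶠ n in atTop, invCNorm (Sobolev.fn (b n)) < ⊤) (ha : invCNorm (Sobolev.fn a) < ⊤) :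
    Tendsto (fun n => (invCNorm (Sobolev.fn (b n))).toReal) atTop
      (𝓝 (invCNorm (Sobolev.fn a)).toReal) := by
  rw [tendsto_order]
  refine ⟨fun r hr => Sobolev.lt_invCNorm_eventually hp
    (Sobolev.weakConv_toL2_of_tendsto hp hba) hb ha hr, fun r hr => ?_⟩
  obtain ⟨s, hs, hsr⟩ := exists_between hr
  have hs0 : 0 < s := ENNReal.toReal_nonneg.trans_lt hs
  filter_upwards [Sobolev.eventually_invCNorm_le hk hkp hba hb
    ((ENNReal.lt_ofReal_iff_toReal_lt ha.ne).mpr hs)] with n hn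
  exact (ENNReal.toReal_le_of_le_ofReal hs0.le hn).trans_lt hsr

end Representative

/-! ### Embedding of the phase space in `L²(𝕋³; ℂ⁵)` and Fourier coefficients. -/

section ComplexEmbedding

/-- The embedding of `ℝ` into the `j`-th coordinate of `ℂ⁵`. -/
noncomputable def coordEmb (j : Fin 5) : ℝ →L[ℝ] EuclideanSpace ℂ (Fin 5) :=
  ContinuousLinearMap.toSpanSingleton ℝ (EuclideanSpace.single j (1 : ℂ))

/-- The embedding of `ℝ³` into the last three coordinates of `ℂ⁵`. -/
noncomputable def velocityEmb : EuclideanSpace ℝ (Fin 3) →L[ℝ] EuclideanSpace ℂ (Fin 5) :=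
  (coordEmb 2).comp (EuclideanSpace.proj 0) + (coordEmb 3).comp (EuclideanSpace.proj 1) +
    (coordEmb 4).comp (EuclideanSpace.proj 2)

theorem coordEmb_apply (j : Fin 5) (r : ℝ) (i : Fin 5) :
    coordEmb j r i = if i = j then (r : ℂ) else 0 := by
  rw [coordEmb, ContinuousLinearMap.toSpanSingleton_apply, PiLp.smul_apply,
    PiLp.single_apply]
  split_ifs <;> simp

theorem velocityEmb_apply (u : EuclideanSpace ℝ (Fin 3)) (i : Fin 5) :
    velocityEmb u i = (if i = 2 then (u 0 : ℂ) else 0) + (if i = 3 then (u 1 : ℂ) else 0) +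
      if i = 4 then (u 2 : ℂ) else 0 := by
  simp [velocityEmb, coordEmb_apply]

end ComplexEmbedding

namespace PhaseSpace

variable {q : ℝ≥0∞} [Fact (1 ≤ q)]

theorem norm_eq (U : PhaseSpace q) : ‖U‖ = ‖U.fst‖ + (‖U.snd.fst‖ + ‖U.snd.snd‖) := by
  rw [WithLp.prod_norm_eq_of_L1, WithLp.prod_norm_eq_of_L1]

theorem tendsto_iff {u : ℕ → PhaseSpace q} {U : PhaseSpace q} :
    Tendsto u atTop (𝓝 U) ↔ Tendsto (fun n => (u n).fst) atTop (𝓝 U.fst) ∧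
      Tendsto (fun n => (u n).snd.fst) atTop (𝓝 U.snd.fst) ∧
        Tendsto (fun n => (u n).snd.snd) atTop (𝓝 U.snd.snd) := by
  constructor
  · intro h
    have h1 : Tendsto (fun n => (u n).snd) atTop (𝓝 U.snd) :=
      ((WithLp.continuous_snd 1 _ _).tendsto U).comp h
    exact ⟨((WithLp.continuous_fst 1 _ _).tendsto U).comp h,
      ((WithLp.continuous_fst 1 _ _).tendsto U.snd).comp h1,
      ((WithLp.continuous_snd 1 _ _).tendsto U.snd).comp h1⟩
  · rintro ⟨h1, h2, h3⟩
    rw [tendsto_iff_dist_tendsto_zero] at h1 h2 h3 ⊢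
    simp only [WithLp.prod_dist_eq_of_L1]
    simpa only [add_zero] using h1.add (h2.add h3)

theorem norm_le_size (U : PhaseSpace q) : ‖U‖ ≤ U.size := by
  rw [size, add_assoc]
  exact le_add_of_nonneg_right (add_nonneg ENNReal.toReal_nonneg ENNReal.toReal_nonneg)

theorem size_nonneg (U : PhaseSpace q) : 0 ≤ U.size := (norm_nonneg U).trans U.norm_le_size

/-- The projection to the pair `(ϑ, u)`. -/
noncomputable def restL :
    PhaseSpace q →L[ℝ] WithLp 1 (Sobolev 2 2 ℝ × Sobolev 2 2 (EuclideanSpace ℝ (Fin 3))) :=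
  WithLp.sndL 1 ℝ (Sobolev 1 q ℝ)
    (WithLp 1 (Sobolev 2 2 ℝ × Sobolev 2 2 (EuclideanSpace ℝ (Fin 3))))

/-- The projection to the density. -/
noncomputable def densityL : PhaseSpace q →L[ℝ] Sobolev 1 q ℝ :=
  WithLp.fstL 1 ℝ (Sobolev 1 q ℝ)
    (WithLp 1 (Sobolev 2 2 ℝ × Sobolev 2 2 (EuclideanSpace ℝ (Fin 3))))

/-- The projection to the temperature. -/
noncomputable def temperatureL : PhaseSpace q →L[ℝ] Sobolev 2 2 ℝ :=
  (WithLp.fstL 1 ℝ (Sobolev 2 2 ℝ) (Sobolev 2 2 (EuclideanSpace ℝ (Fin 3)))).comp restL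

/-- The projection to the velocity. -/
noncomputable def velocityL : PhaseSpace q →L[ℝ] Sobolev 2 2 (EuclideanSpace ℝ (Fin 3)) :=
  (WithLp.sndL 1 ℝ (Sobolev 2 2 ℝ) (Sobolev 2 2 (EuclideanSpace ℝ (Fin 3)))).comp restL

/-- The class of `(ϱ, ϑ, u)` in `L²(𝕋³; ℂ⁵)`. -/
noncomputable def toL2C5 (hq : 2 ≤ q) : PhaseSpace q →L[ℝ] L2C5 :=
  ((coordEmb 0).compLpL 2 volume).comp ((Sobolev.toL2 hq).comp densityL) +
  ((coordEmb 1).compLpL 2 volume).comp ((Sobolev.toL2 le_rfl).comp temperatureL) +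
  (velocityEmb.compLpL 2 volume).comp ((Sobolev.toL2 le_rfl).comp velocityL)

theorem coeFn_toL2C5 (hq : 2 ≤ q) (U : PhaseSpace q) :
    ∀ᵐ x, toL2C5 hq U x = coordEmb 0 (Sobolev.toL2 hq U.fst x) +
      coordEmb 1 (Sobolev.toL2 le_rfl U.snd.fst x) +
        velocityEmb (Sobolev.toL2 le_rfl U.snd.snd x) := by
  have h : toL2C5 hq U = (coordEmb 0).compLpL 2 volume (Sobolev.toL2 hq U.fst) +
      (coordEmb 1).compLpL 2 volume (Sobolev.toL2 le_rfl U.snd.fst) +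
        velocityEmb.compLpL 2 volume (Sobolev.toL2 le_rfl U.snd.snd) := rfl
  rw [h]
  filter_upwards [Lp.coeFn_add ((coordEmb 0).compLpL 2 volume (Sobolev.toL2 hq U.fst) +
      (coordEmb 1).compLpL 2 volume (Sobolev.toL2 le_rfl U.snd.fst))
      (velocityEmb.compLpL 2 volume (Sobolev.toL2 le_rfl U.snd.snd)),
    Lp.coeFn_add ((coordEmb 0).compLpL 2 volume (Sobolev.toL2 hq U.fst))
      ((coordEmb 1).compLpL 2 volume (Sobolev.toL2 le_rfl U.snd.fst)),
    ContinuousLinearMap.coeFn_compLpL (coordEmb 0) (Sobolev.toL2 hq U.fst),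
    ContinuousLinearMap.coeFn_compLpL (coordEmb 1) (Sobolev.toL2 le_rfl U.snd.fst),
    ContinuousLinearMap.coeFn_compLpL velocityEmb (Sobolev.toL2 le_rfl U.snd.snd)]
    with x h1 h2 h3 h4 h5
  rw [h1, Pi.add_apply, h2, Pi.add_apply, h3, h4, h5]

theorem toL2C5_apply_ae (hq : 2 ≤ q) (U : PhaseSpace q) :
    ∀ᵐ x, ∀ j, toL2C5 hq U x j = (U.vec x j : ℂ) := by
  filter_upwards [coeFn_toL2C5 hq U, Sobolev.coeFn_toL2 hq U.fst,
    Sobolev.coeFn_toL2 le_rfl U.snd.fst, Sobolev.coeFn_toL2 le_rfl U.snd.snd] with x h1 h2 h3 h4 j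
  rw [h1, h2, h3, h4]
  simp only [PiLp.add_apply, coordEmb_apply, velocityEmb_apply, vec, density, temperature, velocity]
  fin_cases j <;> simp

/-- The inner product is conjugate linear in its first slot, and there `U` is real, so the
conjugation disappears. -/
theorem fourierF_eq_inner (hq : 2 ≤ q) (e : HilbertBasis (Fin 5 → ℤ) ℂ L2C5) (k : Fin 5 → ℤ)
    (U : PhaseSpace q) : fourierF e k U = inner ℂ (toL2C5 hq U) (e k) := by
  rw [fourierF, L2.inner_def]
  refine integral_congr_ae ?_
  filter_upwards [toL2C5_apply_ae hq U] with x hx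
  rw [PiLp.inner_apply]
  refine Finset.sum_congr rfl fun j _ => ?_
  rw [RCLike.inner_apply', hx j, Complex.conj_ofReal]

theorem continuous_fourierF (hq : 2 ≤ q) (e : HilbertBasis (Fin 5 → ℤ) ℂ L2C5)
    (k : Fin 5 → ℤ) : Continuous (fourierF e k : PhaseSpace q → ℂ) := by
  have : (fourierF e k : PhaseSpace q → ℂ) = fun U => inner ℂ (toL2C5 hq U) (e k) :=
    funext fun U => fourierF_eq_inner hq e k U
  rw [this]
  exact (toL2C5 hq).continuous.inner continuous_const

theorem norm_fourierF_le (hq : 2 ≤ q) (e : HilbertBasis (Fin 5 → ℤ) ℂ L2C5)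
    (k : Fin 5 → ℤ) (U : PhaseSpace q) : ‖fourierF e k U‖ ≤ ‖toL2C5 hq‖ * ‖U‖ := by
  rw [fourierF_eq_inner hq]
  refine (norm_inner_le_norm _ _).trans ?_
  rw [e.orthonormal.1 k, mul_one]
  exact (toL2C5 hq).le_opNorm U

/-- Recovers real `L²` pairings of single components from complex pairings in `L²(𝕋³; ℂ⁵)`. -/
theorem re_inner_compLpL {E : Type*} [NormedAddCommGroup E] [InnerProductSpace ℝ E]
    (T : E →L[ℝ] EuclideanSpace ℂ (Fin 5)) (g : Lp E 2 (volume : Measure T3)) (f : L2C5)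
    (v : Lp E 2 (volume : Measure T3))
    (h : ∀ᵐ x, ∀ a, (inner ℂ (T a) (f x)).re = inner ℝ a (v x)) :
    (inner ℂ (T.compLpL 2 volume g : L2C5) f).re = inner ℝ g v := by
  rw [L2.inner_def, L2.inner_def]
  have h1 := integral_re (L2.integrable_inner (𝕜 := ℂ) (T.compLpL 2 volume g : L2C5) f)
  refine h1.symm.trans (integral_congr_ae ?_)
  filter_upwards [h, ContinuousLinearMap.coeFn_compLpL T g] with x hx hx'
  rw [hx']
  exact hx _

theorem re_inner_density (hq : 2 ≤ q) (U : PhaseSpace q) (g : Lp ℝ 2 (volume : Measure T3)) :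
    (inner ℂ ((coordEmb 0).compLpL 2 volume g : L2C5) (toL2C5 hq U)).re =
      inner ℝ g (Sobolev.toL2 hq U.fst) := by
  refine re_inner_compLpL _ _ _ _ ?_
  filter_upwards [coeFn_toL2C5 hq U] with x hx a
  rw [hx, PiLp.inner_apply]
  simp [Fin.sum_univ_five, coordEmb_apply, velocityEmb_apply, mul_comm]

theorem re_inner_temperature (hq : 2 ≤ q) (U : PhaseSpace q) (g : Lp ℝ 2 (volume : Measure T3)) :
    (inner ℂ ((coordEmb 1).compLpL 2 volume g : L2C5) (toL2C5 hq U)).re =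
      inner ℝ g (Sobolev.toL2 le_rfl U.snd.fst) := by
  refine re_inner_compLpL _ _ _ _ ?_
  filter_upwards [coeFn_toL2C5 hq U] with x hx a
  rw [hx, PiLp.inner_apply]
  simp [Fin.sum_univ_five, coordEmb_apply, velocityEmb_apply, mul_comm]

theorem re_inner_velocity (hq : 2 ≤ q) (U : PhaseSpace q)
    (g : Lp (EuclideanSpace ℝ (Fin 3)) 2 (volume : Measure T3)) :
    (inner ℂ (velocityEmb.compLpL 2 volume g : L2C5) (toL2C5 hq U)).re =
      inner ℝ g (Sobolev.toL2 le_rfl U.snd.snd) := by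
  refine re_inner_compLpL _ _ _ _ ?_
  filter_upwards [coeFn_toL2C5 hq U] with x hx a
  rw [hx, PiLp.inner_apply, PiLp.inner_apply]
  simp [Fin.sum_univ_five, Fin.sum_univ_three, coordEmb_apply, velocityEmb_apply, mul_comm]

theorem ext_components {U V : PhaseSpace q} (h1 : U.fst = V.fst) (h2 : U.snd.fst = V.snd.fst)
    (h3 : U.snd.snd = V.snd.snd) : U = V := by
  rw [← dist_eq_zero, WithLp.prod_dist_eq_of_L1, WithLp.prod_dist_eq_of_L1, h1, h2, h3, dist_self,
    dist_self, dist_self, add_zero, add_zero]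

theorem toL2C5_injective (hq : 2 ≤ q) : Function.Injective (toL2C5 hq : PhaseSpace q → L2C5) := by
  intro U V h
  have h1 : Sobolev.toL2 hq U.fst = Sobolev.toL2 hq V.fst := ext_inner_left ℝ fun g => by
    rw [← re_inner_density, ← re_inner_density, h]
  have h2 : Sobolev.toL2 le_rfl U.snd.fst = Sobolev.toL2 le_rfl V.snd.fst :=
    ext_inner_left ℝ fun g => by
      rw [← re_inner_temperature hq, ← re_inner_temperature hq, h]
  have h3 : Sobolev.toL2 le_rfl U.snd.snd = Sobolev.toL2 le_rfl V.snd.snd :=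
    ext_inner_left ℝ fun g => by
      rw [← re_inner_velocity hq, ← re_inner_velocity hq, h]
  exact ext_components (Sobolev.toL2_injective hq h1) (Sobolev.toL2_injective le_rfl h2)
    (Sobolev.toL2_injective le_rfl h3)

theorem eq_of_fourierF_eq (hq : 2 ≤ q) (e : HilbertBasis (Fin 5 → ℤ) ℂ L2C5) {U V : PhaseSpace q}
    (h : ∀ k, fourierF e k U = fourierF e k V) : U = V := by
  refine toL2C5_injective hq (e.repr.injective ?_)
  ext k
  rw [e.repr_apply_apply, e.repr_apply_apply, ← inner_conj_symm, ← inner_conj_symm (e k),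
    ← fourierF_eq_inner, ← fourierF_eq_inner, h]

/-- The basis has dense span, so norm boundedness and convergence of all coefficients give weak
convergence. Conjugation exchanges the two slots of the inner product. -/
theorem tendsto_inner_toL2C5 (hq : 2 ≤ q) (e : HilbertBasis (Fin 5 → ℤ) ℂ L2C5)
    {u : ℕ → PhaseSpace q} {U : PhaseSpace q} {C : ℝ} (hC : ∀ᶠ n in atTop, ‖u n‖ ≤ C)
    (h : ∀ k, Tendsto (fun n => fourierF e k (u n)) atTop (𝓝 (fourierF e k U))) (g : L2C5) :
    Tendsto (fun n => inner ℂ g (toL2C5 hq (u n))) atTop (𝓝 (inner ℂ g (toL2C5 hq U))) := by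
  refine tendsto_inner_of_forall_mem (C := ‖toL2C5 hq‖ * C) (s := Set.range e) ?_ ?_ ?_ g
  · filter_upwards [hC] with n hn
    refine ((toL2C5 hq).le_opNorm _).trans ?_
    gcongr
  · rw [Submodule.dense_iff_topologicalClosure_eq_top]
    exact e.dense_span
  · rintro _ ⟨k, rfl⟩
    have := (Complex.continuous_conj.tendsto _).comp (h k)
    simp only [fourierF_eq_inner hq, Function.comp_def] at this
    simpa only [inner_conj_symm] using this

section WeakToStrong

variable {hq : 2 ≤ q} {e : HilbertBasis (Fin 5 → ℤ) ℂ L2C5} {u : ℕ → PhaseSpace q}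
  {U : PhaseSpace q} {C : ℝ}

theorem weakConv_density (hC : ∀ᶠ n in atTop, ‖u n‖ ≤ C)
    (h : ∀ k, Tendsto (fun n => fourierF e k (u n)) atTop (𝓝 (fourierF e k U))) :
    WeakConv (fun n => Sobolev.toL2 hq (u n).fst) (Sobolev.toL2 hq U.fst) :=
  weakConv_of_tendsto_inner fun g => by
    have := (Complex.continuous_re.tendsto _).comp
      (tendsto_inner_toL2C5 hq e hC h ((coordEmb 0).compLpL 2 volume g))
    simpa only [Function.comp_def, re_inner_density] using this

theorem weakConv_temperature (hq : 2 ≤ q) (hC : ∀ᶠ n in atTop, ‖u n‖ ≤ C)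
    (h : ∀ k, Tendsto (fun n => fourierF e k (u n)) atTop (𝓝 (fourierF e k U))) :
    WeakConv (fun n => Sobolev.toL2 le_rfl (u n).snd.fst) (Sobolev.toL2 le_rfl U.snd.fst) :=
  weakConv_of_tendsto_inner fun g => by
    have := (Complex.continuous_re.tendsto _).comp
      (tendsto_inner_toL2C5 hq e hC h ((coordEmb 1).compLpL 2 volume g))
    simpa only [Function.comp_def, re_inner_temperature] using this

theorem weakConv_velocity (hq : 2 ≤ q) (hC : ∀ᶠ n in atTop, ‖u n‖ ≤ C)
    (h : ∀ k, Tendsto (fun n => fourierF e k (u n)) atTop (𝓝 (fourierF e k U))) :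
    WeakConv (fun n => Sobolev.toL2 le_rfl (u n).snd.snd) (Sobolev.toL2 le_rfl U.snd.snd) :=
  weakConv_of_tendsto_inner fun g => by
    have := (Complex.continuous_re.tendsto _).comp
      (tendsto_inner_toL2C5 hq e hC h (velocityEmb.compLpL 2 volume g))
    simpa only [Function.comp_def, re_inner_velocity] using this

end WeakToStrong

end PhaseSpace

/-! ### Convergence of the size versus strong convergence. -/

section LowerLimit

/-- `a ≤ liminf x`. -/
def LeLiminf (a : ℝ) (x : ℕ → ℝ) : Prop := ∀ r < a, ∀ᶠ n in atTop, r < x n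

theorem LeLiminf.add {a b : ℝ} {x y : ℕ → ℝ} (hx : LeLiminf a x) (hy : LeLiminf b y) :
    LeLiminf (a + b) (fun n => x n + y n) := by
  intro r hr
  filter_upwards [hx (a - (a + b - r) / 2) (by linarith), hy (b - (a + b - r) / 2) (by linarith)]
    with n h1 h2
  linarith

/-- If the sum converges to the sum of the lower bounds, an excess of `x` over `a` would have to be
paid for by `y` falling below `b`. -/
theorem LeLiminf.tendsto_left {a b : ℝ} {x y : ℕ → ℝ} (hx : LeLiminf a x) (hy : LeLiminf b y)
    (h : Tendsto (fun n => x n + y n) atTop (𝓝 (a + b))) : Tendsto x atTop (𝓝 a) := by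
  rw [tendsto_order]
  refine ⟨hx, fun r hr => ?_⟩
  filter_upwards [hy (b - (r - a) / 2) (by linarith),
    (tendsto_order.mp h).2 (a + b + (r - a) / 2) (by linarith)] with n h1 h2
  linarith

theorem LeLiminf.tendsto_right {a b : ℝ} {x y : ℕ → ℝ} (hx : LeLiminf a x) (hy : LeLiminf b y)
    (h : Tendsto (fun n => x n + y n) atTop (𝓝 (a + b))) : Tendsto y atTop (𝓝 b) :=
  hy.tendsto_left hx (by simpa only [add_comm] using h)

end LowerLimit

theorem three_div_toReal_lt_one {q : ℝ≥0∞} (hq3 : 3 < q) (hq6 : q ≤ 6) :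
    3 / q.toReal < (1 : ℕ) := by
  have hqt : q ≠ ⊤ := (hq6.trans_lt (by simp)).ne
  have : (3 : ℝ) < q.toReal := by
    simpa using (ENNReal.toReal_lt_toReal (by simp) hqt).mpr hq3
  rw [Nat.cast_one, div_lt_one (by linarith)]
  exact this

section SizeConvergence

variable {q : ℝ≥0∞} [Fact (1 ≤ q)]

theorem three_div_two_lt_two : 3 / (2 : ℝ≥0∞).toReal < (2 : ℕ) := by norm_num

theorem PhaseSpace.tendsto_size (hq3 : 3 < q) (hq6 : q ≤ 6) {u : ℕ → PhaseSpace q}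
    {U : PhaseSpace q} (hu : ∀ᶠ n in atTop, u n ∈ XPlus q) (hU : U ∈ XPlus q)
    (h : Tendsto u atTop (𝓝 U)) : Tendsto (fun n => (u n).size) atTop (𝓝 U.size) := by
  have hq2 : 2 ≤ q := (show (2 : ℝ≥0∞) ≤ 3 by norm_num).trans hq3.le
  obtain ⟨h1, h2, -⟩ := PhaseSpace.tendsto_iff.mp h
  exact (h.norm.add (Sobolev.tendsto_invCNorm hq2 one_le_two (three_div_toReal_lt_one hq3 hq6) h1
    (hu.mono fun n hn => hn.1) hU.1)).add (Sobolev.tendsto_invCNorm le_rfl le_rfl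
      three_div_two_lt_two h2 (hu.mono fun n hn => hn.2) hU.2)

/-- All five summands of the size are lower semicontinuous along the sequence, so convergence of the
total splits into convergence of each. The three norms then upgrade weak to strong convergence. -/
theorem PhaseSpace.tendsto_of_tendsto_size (hq3 : 3 < q) (hq6 : q ≤ 6)
    (e : HilbertBasis (Fin 5 → ℤ) ℂ L2C5) {u : ℕ → PhaseSpace q}
    {U : PhaseSpace q} (hu : ∀ᶠ n in atTop, u n ∈ XPlus q) (hU : U ∈ XPlus q)
    (hs : Tendsto (fun n => (u n).size) atTop (𝓝 U.size))
    (h : ∀ k, Tendsto (fun n => fourierF e k (u n)) atTop (𝓝 (fourierF e k U))) :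
    Tendsto u atTop (𝓝 U) := by
  have hq2 : 2 ≤ q := (show (2 : ℝ≥0∞) ≤ 3 by norm_num).trans hq3.le
  have hqt : q ≠ ⊤ := (hq6.trans_lt (by simp)).ne
  have h2t : (2 : ℝ≥0∞) ≠ ⊤ := by simp
  have hC : ∀ᶠ n in atTop, ‖u n‖ ≤ U.size + 1 := by
    filter_upwards [hs.eventually (gt_mem_nhds (lt_add_one U.size))] with n hn
    exact ((u n).norm_le_size).trans hn.le
  have hC1 : ∀ᶠ n in atTop, ‖(u n).fst‖ ≤ U.size + 1 := hC.mono fun n hn => by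
    rw [PhaseSpace.norm_eq] at hn
    linarith [norm_nonneg (u n).snd.fst, norm_nonneg (u n).snd.snd]
  have hC2 : ∀ᶠ n in atTop, ‖(u n).snd.fst‖ ≤ U.size + 1 := hC.mono fun n hn => by
    rw [PhaseSpace.norm_eq] at hn
    linarith [norm_nonneg (u n).fst, norm_nonneg (u n).snd.snd]
  have hC3 : ∀ᶠ n in atTop, ‖(u n).snd.snd‖ ≤ U.size + 1 := hC.mono fun n hn => by
    rw [PhaseSpace.norm_eq] at hn
    linarith [norm_nonneg (u n).fst, norm_nonneg (u n).snd.fst]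
  have w1 := PhaseSpace.weakConv_density (hq := hq2) hC h
  have w2 := PhaseSpace.weakConv_temperature hq2 hC h
  have w3 := PhaseSpace.weakConv_velocity hq2 hC h
  have l1 : LeLiminf ‖U.fst‖ fun n => ‖(u n).fst‖ :=
    fun r hr => Sobolev.lt_norm_eventually hq2 hqt hC1 w1 hr
  have l2 : LeLiminf ‖U.snd.fst‖ fun n => ‖(u n).snd.fst‖ :=
    fun r hr => Sobolev.lt_norm_eventually le_rfl h2t hC2 w2 hr
  have l3 : LeLiminf ‖U.snd.snd‖ fun n => ‖(u n).snd.snd‖ :=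
    fun r hr => Sobolev.lt_norm_eventually le_rfl h2t hC3 w3 hr
  have l4 : LeLiminf (invCNorm U.density).toReal fun n => (invCNorm (u n).density).toReal :=
    fun r hr => Sobolev.lt_invCNorm_eventually hq2 w1 (hu.mono fun n hn => hn.1) hU.1 hr
  have l5 : LeLiminf (invCNorm U.temperature).toReal fun n => (invCNorm (u n).temperature).toReal :=
    fun r hr => Sobolev.lt_invCNorm_eventually le_rfl w2 (hu.mono fun n hn => hn.2) hU.2 hr
  have l23 := l2.add l3
  have l123 := l1.add l23
  simp only [PhaseSpace.size, PhaseSpace.norm_eq] at hs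
  have t1234 := (l123.add l4).tendsto_left l5 hs
  have t123 := l123.tendsto_left l4 t1234
  have t1 := l1.tendsto_left l23 t123
  have t23 := l1.tendsto_right l23 t123
  have t2 := l2.tendsto_left l3 t23
  have t3 := l2.tendsto_right l3 t23
  exact PhaseSpace.tendsto_iff.mpr ⟨Sobolev.tendsto_of_weakConv hq2 hqt t1 w1,
    Sobolev.tendsto_of_weakConv le_rfl h2t t2 w2, Sobolev.tendsto_of_weakConv le_rfl h2t t3 w3⟩

/-- A bound on the size keeps densities and temperatures uniformly away from zero, so a strong limit
cannot leave `X⁺`. This gives the closed range of the embedding below. -/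
theorem PhaseSpace.mem_XPlus_of_tendsto (hq3 : 3 < q) (hq6 : q ≤ 6) {u : ℕ → PhaseSpace q}
    {U : PhaseSpace q} {C : ℝ} (hu : ∀ᶠ n in atTop, u n ∈ XPlus q ∧ (u n).size ≤ C)
    (h : Tendsto u atTop (𝓝 U)) : U ∈ XPlus q := by
  obtain ⟨N, hN⟩ := eventually_atTop.mp hu
  obtain ⟨h1, h2, -⟩ := PhaseSpace.tendsto_iff.mp ((tendsto_add_atTop_iff_nat N).mpr h)
  have hN' : ∀ n, u (n + N) ∈ XPlus q ∧ (u (n + N)).size ≤ C := fun n => hN _ (Nat.le_add_left _ _)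
  have hC : 0 < C + 1 := by linarith [(u (0 + N)).size_nonneg, (hN' 0).2]
  have key : ∀ n, invCNorm (u (n + N)).density ≤ ENNReal.ofReal (C + 1) ∧
      invCNorm (u (n + N)).temperature ≤ ENNReal.ofReal (C + 1) := by
    intro n
    have hs := (hN' n).2
    have h0 := norm_nonneg (u (n + N))
    have ha : 0 ≤ (invCNorm (u (n + N)).density).toReal := ENNReal.toReal_nonneg
    have hb : 0 ≤ (invCNorm (u (n + N)).temperature).toReal := ENNReal.toReal_nonneg
    rw [PhaseSpace.size] at hs
    exact ⟨(ENNReal.le_ofReal_iff_toReal_le (hN' n).1.1.ne hC.le).mpr (by linarith),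
      (ENNReal.le_ofReal_iff_toReal_le (hN' n).1.2.ne hC.le).mpr (by linarith)⟩
  exact ⟨(Sobolev.invCNorm_le_of_tendsto one_le_two (three_div_toReal_lt_one hq3 hq6) h1 hC
      fun n => (key n).1).trans_lt ENNReal.ofReal_lt_top,
    (Sobolev.invCNorm_le_of_tendsto le_rfl three_div_two_lt_two h2 hC
      fun n => (key n).2).trans_lt ENNReal.ofReal_lt_top⟩

end SizeConvergence

/-! ### The weight `G`. -/

namespace XPlusInf

variable {q : ℝ≥0∞} [Fact (1 ≤ q)]

/-- The added point is really new, so the weight vanishes there and nowhere else. -/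
theorem zero_notMem_XPlus : (0 : PhaseSpace q) ∉ XPlus q := fun h => by
  have : (0 : PhaseSpace q).density =ᵐ[volume] 0 := Lp.coeFn_zero ℝ q volume
  exact h.1.ne (invCNorm_of_ae_zero this)

theorem eq_infty_of_notMem {U : XPlusInf q} (h : U.toX ∉ XPlus q) : U = infty q :=
  Subtype.ext ((U.2.resolve_left h : U.1 = 0))

theorem weight_of_mem {U : XPlusInf q} (h : U.toX ∈ XPlus q) :
    U.weight = ((1 + U.toX.size) ^ 2)⁻¹ := if_pos h

theorem weight_of_notMem {U : XPlusInf q} (h : U.toX ∉ XPlus q) : U.weight = 0 := if_neg h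

theorem weight_infty : (infty q).weight = 0 := weight_of_notMem zero_notMem_XPlus

theorem weight_pos_iff {U : XPlusInf q} : 0 < U.weight ↔ U.toX ∈ XPlus q := by
  refine ⟨fun h => ?_, fun h => ?_⟩
  · by_contra hc
    exact h.ne' (weight_of_notMem hc)
  · rw [weight_of_mem h]
    have := U.toX.size_nonneg
    positivity

theorem weight_nonneg (U : XPlusInf q) : 0 ≤ U.weight := by
  by_cases h : U.toX ∈ XPlus q
  · exact (weight_pos_iff.mpr h).le
  · exact (weight_of_notMem h).ge

theorem eq_infty_of_weight_eq_zero {U : XPlusInf q} (h : U.weight = 0) : U = infty q :=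
  eq_infty_of_notMem fun hm => (weight_pos_iff.mpr hm).ne' h

theorem sqrt_weight_of_mem {U : XPlusInf q} (h : U.toX ∈ XPlus q) :
    √U.weight = (1 + U.toX.size)⁻¹ := by
  have := U.toX.size_nonneg
  rw [weight_of_mem h, Real.sqrt_inv, Real.sqrt_sq (by linarith)]

theorem size_eq_of_mem {U : XPlusInf q} (h : U.toX ∈ XPlus q) :
    U.toX.size = (√U.weight)⁻¹ - 1 := by
  rw [sqrt_weight_of_mem h, inv_inv]
  ring

/-- The reason for the square in `G`: a weight `(1 + S)⁻¹` would only make the product bounded,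
whereas here it vanishes with `G`. -/
theorem weight_mul_norm_le (U : XPlusInf q) : U.weight * ‖U.toX‖ ≤ √U.weight := by
  by_cases h : U.toX ∈ XPlus q
  · have h0 := U.toX.size_nonneg
    rw [sqrt_weight_of_mem h, weight_of_mem h]
    calc ((1 + U.toX.size) ^ 2)⁻¹ * ‖U.toX‖ ≤ ((1 + U.toX.size) ^ 2)⁻¹ * (1 + U.toX.size) := by
          gcongr
          linarith [U.toX.norm_le_size]
      _ = (1 + U.toX.size)⁻¹ := by field_simp
  · rw [weight_of_notMem h]
    simp

theorem tendsto_weight_zero_iff {u : ℕ → XPlusInf q} :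
    Tendsto (fun n => (u n).weight) atTop (𝓝 0) ↔
      ∀ M : ℝ, 0 < M → ∃ N : ℕ, ∀ n ≥ N, u n = infty q ∨ M < (u n).toX.size := by
  constructor
  · intro h M hM
    have h1 : Tendsto (fun n => √(u n).weight) atTop (𝓝 0) := by
      simpa [Function.comp_def] using (Real.continuous_sqrt.tendsto 0).comp h
    obtain ⟨N, hN⟩ := eventually_atTop.mp
      (h1.eventually (gt_mem_nhds (show (0 : ℝ) < (1 + M)⁻¹ by positivity)))
    refine ⟨N, fun n hn => ?_⟩
    by_cases hm : (u n).toX ∈ XPlus q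
    · right
      have := hN n hn
      have h0 := (u n).toX.size_nonneg
      rw [sqrt_weight_of_mem hm, inv_lt_inv₀ (by linarith) (by linarith)] at this
      linarith
    · exact Or.inl (eq_infty_of_notMem hm)
  · intro h
    rw [Metric.tendsto_atTop]
    intro ε hε
    obtain ⟨N, hN⟩ := h ε⁻¹ (inv_pos.mpr hε)
    refine ⟨N, fun n hn => ?_⟩
    rw [Real.dist_0_eq_abs, abs_of_nonneg (weight_nonneg _)]
    rcases hN n hn with h1 | h1
    · rw [h1, weight_infty]; exact hε
    · by_cases hm : (u n).toX ∈ XPlus q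
      · rw [weight_of_mem hm, inv_lt_comm₀ (by have := (u n).toX.size_nonneg; positivity) hε]
        nlinarith [(u n).toX.size_nonneg]
      · rw [weight_of_notMem hm]; exact hε

theorem tendsto_weight_of_tendsto (hq3 : 3 < q) (hq6 : q ≤ 6) {u : ℕ → XPlusInf q} {U : XPlusInf q}
    (hU : U.toX ∈ XPlus q) (hu : ∀ᶠ n in atTop, (u n).toX ∈ XPlus q)
    (h : Tendsto (fun n => (u n).toX) atTop (𝓝 U.toX)) :
    Tendsto (fun n => (u n).weight) atTop (𝓝 U.weight) := by
  have hs := PhaseSpace.tendsto_size hq3 hq6 hu hU h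
  have h0 : (1 + U.toX.size) ^ 2 ≠ 0 := by have := U.toX.size_nonneg; positivity
  rw [weight_of_mem hU]
  refine (((hs.const_add 1).pow 2).inv₀ h0).congr' ?_
  filter_upwards [hu] with n hn
  rw [weight_of_mem hn]

/-- A positive limit weight keeps the sequence eventually in `X⁺`, where the size is a continuous
function of the weight. -/
theorem tendsto_size_of_tendsto_weight {u : ℕ → XPlusInf q} {g : ℝ} (hg : 0 < g)
    (h : Tendsto (fun n => (u n).weight) atTop (𝓝 g)) :
    (∀ᶠ n in atTop, (u n).toX ∈ XPlus q) ∧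
      Tendsto (fun n => (u n).toX.size) atTop (𝓝 ((√g)⁻¹ - 1)) := by
  have hu : ∀ᶠ n in atTop, (u n).toX ∈ XPlus q :=
    (h.eventually (lt_mem_nhds hg)).mono fun n hn => weight_pos_iff.mp hn
  refine ⟨hu, ?_⟩
  refine ((((Real.continuous_sqrt.tendsto g).comp h).inv₀ (Real.sqrt_pos.mpr hg).ne').sub_const
    1).congr' ?_
  filter_upwards [hu] with n hn
  rw [size_eq_of_mem hn]
  rfl

end XPlusInf

/-! ### The series for `d` and the metric axioms. -/

section Summability

theorem summable_prod_fin {f : ℤ → ℝ} (hf0 : ∀ k, 0 ≤ f k) (hf : Summable f) (n : ℕ) :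
    Summable fun k : Fin n → ℤ => ∏ j, f (k j) := by
  induction n with
  | zero => exact Summable.of_finite
  | succ n ih =>
    rw [← (Fin.consEquiv fun _ : Fin (n + 1) => ℤ).summable_iff]
    have := hf.mul_of_nonneg ih hf0 fun k => Finset.prod_nonneg fun j _ => hf0 _
    refine this.congr fun k => ?_
    simp [Fin.consEquiv, Fin.prod_univ_succ]

theorem summable_exp_neg_abs_div : Summable fun k : ℤ => Real.exp (-|(k : ℝ)| / 5) := by
  have h : Summable fun n : ℕ => Real.exp (-(n : ℝ) / 5) := by
    have := Real.summable_exp_nat_mul_iff.mpr (show (-1 / 5 : ℝ) < 0 by norm_num)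
    refine this.congr fun n => ?_
    congr 1
    ring
  exact Summable.of_nat_of_neg (by simpa using h) (by simpa using h)

/-- The Euclidean length dominates each `|k_j|`, hence their average. This bounds the term by a
product of one-dimensional geometric terms with exponent `|k_j| / 5`. -/
theorem summable_exp_neg_sqrt :
    Summable fun k : Fin 5 → ℤ => Real.exp (-Real.sqrt (∑ j, (k j : ℝ) ^ 2)) := by
  refine Summable.of_nonneg_of_le (fun k => (Real.exp_pos _).le) (fun k => ?_)
    (summable_prod_fin (fun k => (Real.exp_pos _).le) summable_exp_neg_abs_div 5)
  rw [← Real.exp_sum, Real.exp_le_exp]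
  have h : ∀ j, |(k j : ℝ)| ≤ √(∑ j, (k j : ℝ) ^ 2) := fun j =>
    Real.abs_le_sqrt (Finset.single_le_sum (f := fun j => (k j : ℝ) ^ 2)
      (fun i _ => sq_nonneg _) (Finset.mem_univ j))
  rw [Fin.sum_univ_five (fun j => -|(k j : ℝ)| / 5)]
  linarith [h 0, h 1, h 2, h 3, h 4]

/-- The weight `exp(-|k|)` of the index `(i, k)`. -/
noncomputable def phaseCoeff (ik : Fin 2 × (Fin 5 → ℤ)) : ℝ :=
  Real.exp (-Real.sqrt (∑ j, (ik.2 j : ℝ) ^ 2))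

theorem phaseCoeff_pos (ik : Fin 2 × (Fin 5 → ℤ)) : 0 < phaseCoeff ik := Real.exp_pos _

theorem summable_phaseCoeff : Summable phaseCoeff := by
  have h1 : Summable fun _ : Fin 2 => (1 : ℝ) := Summable.of_finite
  have := h1.mul_of_nonneg summable_exp_neg_sqrt (fun _ => zero_le_one)
    fun k => (Real.exp_pos _).le
  exact this.congr fun k => one_mul _

end Summability

theorem div_one_add_le_add {s t r : ℝ} (hs : 0 ≤ s) (ht : 0 ≤ t) (hr : 0 ≤ r) (h : r ≤ s + t) :
    r / (1 + r) ≤ s / (1 + s) + t / (1 + t) := by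
  calc r / (1 + r) ≤ (s + t) / (1 + (s + t)) := by
        rw [div_le_div_iff₀ (by linarith) (by linarith)]
        linarith
    _ = s / (1 + (s + t)) + t / (1 + (s + t)) := add_div _ _ _
    _ ≤ s / (1 + s) + t / (1 + t) := by gcongr <;> linarith

section PhaseMetric

variable {q : ℝ≥0∞} [Fact (1 ≤ q)] (e : HilbertBasis (Fin 5 → ℤ) ℂ L2C5)

theorem phaseTerm_nonneg (U V : XPlusInf q) (ik : Fin 2 × (Fin 5 → ℤ)) :
    0 ≤ phaseTerm e U V ik := by
  unfold phaseTerm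
  positivity

theorem phaseTerm_le (U V : XPlusInf q) (ik : Fin 2 × (Fin 5 → ℤ)) :
    phaseTerm e U V ik ≤ phaseCoeff ik := by
  refine mul_le_of_le_one_right (Real.exp_pos _).le ?_
  rw [div_le_one (by positivity)]
  linarith

theorem summable_phaseTerm (U V : XPlusInf q) : Summable (phaseTerm e U V) :=
  Summable.of_nonneg_of_le (phaseTerm_nonneg e U V) (phaseTerm_le e U V) summable_phaseCoeff

theorem phaseTerm_le_phaseDist (U V : XPlusInf q) (ik : Fin 2 × (Fin 5 → ℤ)) :
    phaseTerm e U V ik ≤ phaseDist e U V :=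
  (summable_phaseTerm e U V).le_tsum ik fun j _ => phaseTerm_nonneg e U V j

theorem phaseDist_self (U : XPlusInf q) : phaseDist e U U = 0 := by
  simp [phaseDist, phaseTerm]

theorem phaseDist_comm (U V : XPlusInf q) : phaseDist e U V = phaseDist e V U := by
  simp only [phaseDist, phaseTerm, norm_sub_rev]

theorem phaseDist_triangle (U V W : XPlusInf q) :
    phaseDist e U W ≤ phaseDist e U V + phaseDist e V W := by
  rw [phaseDist, phaseDist, phaseDist,
    ← (summable_phaseTerm e U V).tsum_add (summable_phaseTerm e V W)]
  refine (summable_phaseTerm e U W).tsum_le_tsum (fun ik => ?_)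
    ((summable_phaseTerm e U V).add (summable_phaseTerm e V W))
  simp only [phaseTerm]
  rw [← mul_add]
  gcongr
  exact div_one_add_le_add (norm_nonneg _) (norm_nonneg _) (norm_nonneg _)
    (norm_sub_le_norm_sub_add_norm_sub _ _ _)

theorem fourierQ_zero (k : Fin 5 → ℤ) (U : XPlusInf q) : fourierQ e 0 k U = (U.weight : ℂ) :=
  if_pos rfl

theorem fourierQ_one (k : Fin 5 → ℤ) (U : XPlusInf q) :
    fourierQ e 1 k U = (U.weight : ℂ) * fourierF e k U.toX :=
  if_neg one_ne_zero

/-- Equal weights are both zero, forcing both points to be `U_∞`, or can be cancelled, leaving equal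
Fourier coefficients. -/
theorem eq_of_phaseDist_eq_zero (hq : 2 ≤ q) {U V : XPlusInf q} (h : phaseDist e U V = 0) :
    U = V := by
  have hQ : ∀ i k, fourierQ e i k U = fourierQ e i k V := by
    intro i k
    have h1 : phaseTerm e U V (i, k) = 0 :=
      le_antisymm ((phaseTerm_le_phaseDist e U V _).trans h.le) (phaseTerm_nonneg e U V _)
    rw [phaseTerm, mul_eq_zero, or_iff_right (Real.exp_pos _).ne', div_eq_zero_iff] at h1
    rcases h1 with h1 | h1
    · exact sub_eq_zero.mp (norm_eq_zero.mp h1)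
    · exact absurd h1 (by positivity)
  have hw : U.weight = V.weight := by
    have := hQ 0 0
    rw [fourierQ_zero, fourierQ_zero] at this
    exact_mod_cast this
  by_cases h0 : U.weight = 0
  · rw [XPlusInf.eq_infty_of_weight_eq_zero h0,
      XPlusInf.eq_infty_of_weight_eq_zero (hw.symm.trans h0)]
  · refine Subtype.ext (PhaseSpace.eq_of_fourierF_eq hq e fun k => ?_)
    have := hQ 1 k
    rw [fourierQ_one, fourierQ_one, ← hw] at this
    exact mul_left_cancel₀ (Complex.ofReal_ne_zero.mpr h0) this

/-- The metric `d` on `X⁺_∞`. -/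
noncomputable abbrev phaseMetric (hq : 2 ≤ q) : MetricSpace (XPlusInf q) where
  dist := phaseDist e
  dist_self := phaseDist_self e
  dist_comm := phaseDist_comm e
  dist_triangle := phaseDist_triangle e
  eq_of_dist_eq_zero := eq_of_phaseDist_eq_zero e hq

/-- Each term is controlled by the whole series, and dominated convergence for series gives the
converse. -/
theorem tendsto_phaseDist_iff {u : ℕ → XPlusInf q} {U : XPlusInf q} :
    Tendsto (fun n => phaseDist e (u n) U) atTop (𝓝 0) ↔
      ∀ i k, Tendsto (fun n => fourierQ e i k (u n)) atTop (𝓝 (fourierQ e i k U)) := by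
  constructor
  · intro h i k
    rw [tendsto_iff_norm_sub_tendsto_zero]
    set t : ℕ → ℝ := fun n => ‖fourierQ e i k (u n) - fourierQ e i k U‖
    have h1 : Tendsto (fun n => phaseTerm e (u n) U (i, k)) atTop (𝓝 0) :=
      squeeze_zero (fun n => phaseTerm_nonneg e _ _ _) (fun n => phaseTerm_le_phaseDist e _ _ _) h
    have h2 : Tendsto (fun n => t n / (1 + t n)) atTop (𝓝 0) := by
      have := h1.const_mul (phaseCoeff (i, k))⁻¹
      rw [mul_zero] at this
      refine this.congr fun n => ?_
      exact inv_mul_cancel_left₀ (phaseCoeff_pos (i, k)).ne' _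
    -- The inverse of `t ↦ t / (1 + t)` is `s ↦ s / (1 - s)`, continuous at `0`.
    have h3 : Tendsto (fun n => t n / (1 + t n) / (1 - t n / (1 + t n))) atTop (𝓝 (0 / (1 - 0))) :=
      h2.div (h2.const_sub 1) (by norm_num)
    rw [zero_div] at h3
    refine h3.congr fun n => ?_
    have ht : 0 ≤ t n := norm_nonneg _
    have : 1 + t n ≠ 0 := by positivity
    field_simp
    ring
  · intro h
    have h0 : (0 : ℝ) = ∑' _ : Fin 2 × (Fin 5 → ℤ), (0 : ℝ) := tsum_zero.symm
    rw [h0]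
    refine tendsto_tsum_of_dominated_convergence summable_phaseCoeff (fun ik => ?_)
      (Eventually.of_forall fun n ik => ?_)
    · have h1 := tendsto_iff_norm_sub_tendsto_zero.mp (h ik.1 ik.2)
      have h2 := (h1.div (h1.const_add 1) (by norm_num)).const_mul (phaseCoeff ik)
      rw [zero_div, mul_zero] at h2
      exact h2
    · rw [Real.norm_of_nonneg (phaseTerm_nonneg e _ _ _)]
      exact phaseTerm_le e _ _ _

end PhaseMetric

theorem eq_of_smul_eq_smul {E : Type*} [AddCommGroup E] [Module ℝ E] {c : ℝ} (hc : c ≠ 0) {x y : E}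
    (h : c • x = c • y) : x = y := by
  rw [← inv_smul_smul₀ hc x, h, inv_smul_smul₀ hc]

theorem two_le_of_three_lt {q : ℝ≥0∞} (hq3 : 3 < q) : 2 ≤ q :=
  (show (2 : ℝ≥0∞) ≤ 3 by norm_num).trans hq3.le

/-! ### The closed embedding, the Polish property and the class `𝒞`. -/

section Weighted

variable {q : ℝ≥0∞} [Fact (1 ≤ q)]

instance PhaseSpace.t2Space : T2Space (PhaseSpace q) :=
  @TopologicalSpace.t2Space_of_metrizableSpace _ _
    (@EMetricSpace.metrizableSpace _ (@MetricSpace.toEMetricSpace _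
      (@NormedAddCommGroup.toMetricSpace _ inferInstance)))

/-- The map `U ↦ (G(U) U, G(U))`. -/
noncomputable def XPlusInf.weighted (U : XPlusInf q) : PhaseSpace q × ℝ :=
  (U.weight • U.toX, U.weight)

theorem XPlusInf.tendsto_weight_smul_zero {u : ℕ → XPlusInf q}
    (h : Tendsto (fun n => (u n).weight) atTop (𝓝 0)) :
    Tendsto (fun n => (u n).weight • (u n).toX) atTop (𝓝 0) := by
  rw [tendsto_zero_iff_norm_tendsto_zero]
  have h1 : Tendsto (fun n => √(u n).weight) atTop (𝓝 0) := by
    simpa [Function.comp_def] using (Real.continuous_sqrt.tendsto 0).comp h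
  refine squeeze_zero (fun _ => norm_nonneg _) (fun n => ?_) h1
  rw [norm_smul, Real.norm_of_nonneg (weight_nonneg _)]
  exact weight_mul_norm_le _

theorem XPlusInf.weighted_injective : Function.Injective (XPlusInf.weighted : XPlusInf q → _) := by
  intro U V h
  have hw : U.weight = V.weight := congrArg Prod.snd h
  have hx : U.weight • U.toX = V.weight • V.toX := congrArg Prod.fst h
  by_cases h0 : U.weight = 0
  · rw [eq_infty_of_weight_eq_zero h0, eq_infty_of_weight_eq_zero (hw.symm.trans h0)]
  · rw [← hw] at hx
    exact Subtype.ext (eq_of_smul_eq_smul h0 hx)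

end Weighted

section Convergence

variable {q : ℝ≥0∞} [Fact (1 ≤ q)] {e : HilbertBasis (Fin 5 → ℤ) ℂ L2C5}

theorem tendsto_iff_fourierQ [MetricSpace (XPlusInf q)]
    (hd : ∀ U V : XPlusInf q, dist U V = phaseDist e U V) {u : ℕ → XPlusInf q} {U : XPlusInf q} :
    Tendsto u atTop (𝓝 U) ↔
      ∀ i k, Tendsto (fun n => fourierQ e i k (u n)) atTop (𝓝 (fourierQ e i k U)) := by
  rw [← tendsto_phaseDist_iff, tendsto_iff_dist_tendsto_zero]
  simp only [hd]

theorem tendsto_weight [MetricSpace (XPlusInf q)]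
    (hd : ∀ U V : XPlusInf q, dist U V = phaseDist e U V) {u : ℕ → XPlusInf q} {U : XPlusInf q}
    (h : Tendsto u atTop (𝓝 U)) :
    Tendsto (fun n => (u n).weight) atTop (𝓝 U.weight) := by
  have h1 := (tendsto_iff_fourierQ hd).mp h 0 0
  simp only [fourierQ_zero] at h1
  simpa [Function.comp_def] using (Complex.continuous_re.tendsto _).comp h1

/-- The coordinates `G F_k` need no separate hypothesis: they are bounded by a constant times `G ‖U‖
≤ √G`. -/
theorem tendsto_infty_iff [MetricSpace (XPlusInf q)]
    (hd : ∀ U V : XPlusInf q, dist U V = phaseDist e U V) (hq : 2 ≤ q) {u : ℕ → XPlusInf q} :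
    Tendsto u atTop (𝓝 (XPlusInf.infty q)) ↔ Tendsto (fun n => (u n).weight) atTop (𝓝 0) := by
  refine ⟨fun h => ?_, fun h => (tendsto_iff_fourierQ hd).mpr fun i k => ?_⟩
  · have := tendsto_weight hd h
    rwa [XPlusInf.weight_infty] at this
  · have h1 : Tendsto (fun n => √(u n).weight) atTop (𝓝 0) := by
      simpa [Function.comp_def] using (Real.continuous_sqrt.tendsto 0).comp h
    fin_cases i
    · simp only [Fin.zero_eta, fourierQ_zero, XPlusInf.weight_infty]
      exact (Complex.continuous_ofReal.tendsto 0).comp h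
    · simp only [Fin.mk_one, fourierQ_one, XPlusInf.weight_infty, Complex.ofReal_zero, zero_mul]
      rw [tendsto_zero_iff_norm_tendsto_zero]
      have h2 := h1.const_mul ‖(PhaseSpace.toL2C5 hq : PhaseSpace q →L[ℝ] L2C5)‖
      rw [mul_zero] at h2
      refine squeeze_zero (fun _ => norm_nonneg _) (fun n => ?_) h2
      rw [norm_mul, Complex.norm_of_nonneg (XPlusInf.weight_nonneg _)]
      calc (u n).weight * ‖fourierF e k (u n).toX‖
          ≤ (u n).weight * (‖(PhaseSpace.toL2C5 hq : PhaseSpace q →L[ℝ] L2C5)‖ * ‖(u n).toX‖) := by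
            gcongr
            · exact XPlusInf.weight_nonneg _
            · exact PhaseSpace.norm_fourierF_le hq e k _
        _ = ‖(PhaseSpace.toL2C5 hq : PhaseSpace q →L[ℝ] L2C5)‖ *
              ((u n).weight * ‖(u n).toX‖) := by ring
        _ ≤ _ := by gcongr; exact XPlusInf.weight_mul_norm_le _

/-- Division by the positive limit of `G` recovers the coefficients `F_k` from the coordinates `G
F_k`. -/
theorem tendsto_iff_of_mem [MetricSpace (XPlusInf q)]
    (hd : ∀ U V : XPlusInf q, dist U V = phaseDist e U V) (hq3 : 3 < q) (hq6 : q ≤ 6)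
    {u : ℕ → XPlusInf q} {U : XPlusInf q} (hU : U.toX ∈ XPlus q) :
    Tendsto u atTop (𝓝 U) ↔ (∀ᶠ n in atTop, (u n).toX ∈ XPlus q) ∧
      Tendsto (fun n => (u n).toX) atTop (𝓝 U.toX) := by
  constructor
  · intro h
    have hw := tendsto_weight hd h
    have hwU := XPlusInf.weight_pos_iff.mpr hU
    obtain ⟨hu, hs⟩ := XPlusInf.tendsto_size_of_tendsto_weight hwU hw
    rw [← XPlusInf.size_eq_of_mem hU] at hs
    refine ⟨hu, PhaseSpace.tendsto_of_tendsto_size hq3 hq6 e hu hU hs fun k => ?_⟩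
    have h1 := (tendsto_iff_fourierQ hd).mp h 1 k
    have h0 := (tendsto_iff_fourierQ hd).mp h 0 k
    have hne : fourierQ e 0 k U ≠ 0 := by
      rw [fourierQ_zero]; exact Complex.ofReal_ne_zero.mpr hwU.ne'
    have h2 := h1.div h0 hne
    have hdiv : ∀ V : XPlusInf q, V.toX ∈ XPlus q →
        fourierQ e 1 k V / fourierQ e 0 k V = fourierF e k V.toX := fun V hV => by
      rw [fourierQ_one, fourierQ_zero, mul_div_cancel_left₀ _
        (Complex.ofReal_ne_zero.mpr (XPlusInf.weight_pos_iff.mpr hV).ne')]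
    rw [hdiv U hU] at h2
    refine h2.congr' ?_
    filter_upwards [hu] with n hn using hdiv _ hn
  · rintro ⟨hu, h⟩
    have hw := XPlusInf.tendsto_weight_of_tendsto hq3 hq6 hU hu h
    have hw' := (Complex.continuous_ofReal.tendsto _).comp hw
    refine (tendsto_iff_fourierQ hd).mpr fun i k => ?_
    fin_cases i
    · simp only [Fin.zero_eta, fourierQ_zero]
      exact hw'
    · simp only [Fin.mk_one, fourierQ_one]
      exact hw'.mul
        (((PhaseSpace.continuous_fourierF (two_le_of_three_lt hq3) e k).tendsto _).comp h)

theorem XPlusInf.continuous_weighted [MetricSpace (XPlusInf q)]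
    (hd : ∀ U V : XPlusInf q, dist U V = phaseDist e U V) (hq3 : 3 < q) (hq6 : q ≤ 6) :
    Continuous (XPlusInf.weighted : XPlusInf q → _) := by
  refine SeqContinuous.continuous fun u U h => ?_
  have hw := tendsto_weight hd h
  refine Tendsto.prodMk_nhds ?_ hw
  by_cases hU : U.toX ∈ XPlus q
  · exact hw.smul ((tendsto_iff_of_mem hd hq3 hq6 hU).mp h).2
  · rw [weight_of_notMem hU] at hw ⊢
    rw [zero_smul]
    exact tendsto_weight_smul_zero hw

/-- A zero limit weight forces the limit `(0, 0)`, the image of `U_∞`. A positive one can be divided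
out, and the sizes stay bounded, so the quotient is a point of `X⁺`. -/
theorem XPlusInf.exists_of_tendsto_weighted [MetricSpace (XPlusInf q)]
    (hd : ∀ U V : XPlusInf q, dist U V = phaseDist e U V) (hq3 : 3 < q) (hq6 : q ≤ 6)
    {u : ℕ → XPlusInf q} {y : PhaseSpace q × ℝ}
    (h : Tendsto (fun n => (u n).weighted) atTop (𝓝 y)) :
    ∃ U : XPlusInf q, U.weighted = y ∧ Tendsto u atTop (𝓝 U) := by
  have hx : Tendsto (fun n => (u n).weight • (u n).toX) atTop (𝓝 y.1) :=
    (continuous_fst.tendsto y).comp h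
  have hw : Tendsto (fun n => (u n).weight) atTop (𝓝 y.2) := (continuous_snd.tendsto y).comp h
  rcases (ge_of_tendsto' hw fun n => weight_nonneg _).eq_or_lt with h0 | h0
  · rw [← h0] at hw
    refine ⟨infty q, ?_, (tendsto_infty_iff hd (two_le_of_three_lt hq3)).mpr hw⟩
    have hy := tendsto_nhds_unique hx (tendsto_weight_smul_zero hw)
    refine Prod.ext ?_ ?_
    · simp only [weighted, weight_infty, zero_smul]
      exact hy.symm
    · simp only [weighted, weight_infty]
      exact h0
  · obtain ⟨hu, hs⟩ := tendsto_size_of_tendsto_weight h0 hw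
    obtain ⟨X₀, hX₀⟩ : ∃ X₀, X₀ = y.2⁻¹ • y.1 := ⟨_, rfl⟩
    have hX : Tendsto (fun n => (u n).toX) atTop (𝓝 X₀) := by
      rw [hX₀]
      refine ((hw.inv₀ h0.ne').smul hx).congr' ?_
      filter_upwards [hu] with n hn
      rw [inv_smul_smul₀ (weight_pos_iff.mpr hn).ne']
    have hmem : X₀ ∈ XPlus q := PhaseSpace.mem_XPlus_of_tendsto hq3 hq6
      (hu.and ((hs.eventually (gt_mem_nhds (lt_add_one _))).mono fun n hn => hn.le)) hX
    obtain ⟨U, hUX⟩ : ∃ U : XPlusInf q, U.toX = X₀ := ⟨⟨X₀, Or.inl hmem⟩, rfl⟩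
    rw [← hUX] at hX hmem
    have hU : Tendsto u atTop (𝓝 U) := (tendsto_iff_of_mem hd hq3 hq6 hmem).mpr ⟨hu, hX⟩
    have hwU : U.weight = y.2 := tendsto_nhds_unique (tendsto_weight hd hU) hw
    refine ⟨U, Prod.ext ?_ hwU, hU⟩
    rw [weighted, hwU, hUX, hX₀, smul_inv_smul₀ h0.ne']

theorem XPlusInf.isClosedEmbedding_weighted [MetricSpace (XPlusInf q)]
    (hd : ∀ U V : XPlusInf q, dist U V = phaseDist e U V) (hq3 : 3 < q) (hq6 : q ≤ 6) :
    IsClosedEmbedding (XPlusInf.weighted : XPlusInf q → _) := by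
  refine .of_continuous_injective_isClosedMap (continuous_weighted hd hq3 hq6) weighted_injective
    fun s hs => IsSeqClosed.isClosed fun v y hv hy => ?_
  choose u hus huv using hv
  obtain rfl : v = fun n => weighted (u n) := funext fun n => (huv n).symm
  obtain ⟨U, hU, hlim⟩ := exists_of_tendsto_weighted hd hq3 hq6 hy
  exact ⟨U, hs.isSeqClosed hus hlim, hU⟩

theorem XPlusInf.polishSpace [MetricSpace (XPlusInf q)]
    (hd : ∀ U V : XPlusInf q, dist U V = phaseDist e U V) (hq3 : 3 < q) (hq6 : q ≤ 6) :
    PolishSpace (XPlusInf q) := by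
  have hqt : q ≠ ⊤ := (hq6.trans_lt (by simp)).ne
  have h1 : SecondCountableTopology (Sobolev 1 q ℝ) := Sobolev.secondCountableTopology hqt
  have h2 : SecondCountableTopology (Sobolev 2 2 ℝ) := Sobolev.secondCountableTopology (by simp)
  have h3 : SecondCountableTopology (Sobolev 2 2 (EuclideanSpace ℝ (Fin 3))) :=
    Sobolev.secondCountableTopology (by simp)
  have h4 : SecondCountableTopology (PhaseSpace q) := inferInstance
  have h5 : CompleteSpace (PhaseSpace q) := inferInstance
  exact (isClosedEmbedding_weighted hd hq3 hq6).polishSpace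

theorem XPlusInf.classC_eq [MetricSpace (XPlusInf q)]
    (hd : ∀ U V : XPlusInf q, dist U V = phaseDist e U V) (hq3 : 3 < q) (hq6 : q ≤ 6) :
    classC q = {F : XPlusInf q → ℝ | Continuous F ∧ ∃ C : ℝ, ∀ U, |F U| ≤ C} := by
  have hq2 := two_le_of_three_lt hq3
  ext F
  constructor
  · rintro ⟨hc, ⟨C, hC⟩, hlim⟩
    -- The bound in `𝒞` concerns `X⁺` only, so the value at `U_∞` is added by hand.
    have hval : ∀ U : XPlusInf q, |F U| ≤ max C |F (infty q)| := fun U => by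
      by_cases hU : U.toX ∈ XPlus q
      · exact (hC ⟨U.toX, hU⟩).trans (le_max_left _ _)
      · rw [eq_infty_of_notMem hU]
        exact le_max_right _ _
    refine ⟨SeqContinuous.continuous fun u U h => ?_, _, hval⟩
    by_cases hU : U.toX ∈ XPlus q
    · obtain ⟨hu, hX⟩ := (tendsto_iff_of_mem hd hq3 hq6 hU).mp h
      rw [tendsto_def]
      intro s hs
      have h1 := (hc.tendsto ⟨U.toX, hU⟩).eventually (show s ∈ 𝓝 (F (ofPlus ⟨U.toX, hU⟩)) from hs)
      rw [nhds_subtype_eq_comap, eventually_comap] at h1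
      filter_upwards [hu, hX.eventually h1] with n hn hn'
      exact hn' ⟨(u n).toX, hn⟩ rfl
    · rw [eq_infty_of_notMem hU] at h ⊢
      have h4 := tendsto_weight_zero_iff.mp ((tendsto_infty_iff hd hq2).mp h)
      rw [tendsto_def]
      intro s hs
      have h1 := hlim.eventually hs
      rw [eventually_comap] at h1
      obtain ⟨M, hM⟩ := eventually_atTop.mp h1
      -- The threshold `M` supplied by the filter may be nonpositive, while `h4` needs a positive
      -- one.
      obtain ⟨N, hN⟩ := h4 (max M 1) (by positivity)
      filter_upwards [eventually_ge_atTop N] with n hn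
      rcases hN n hn with h2 | h2
      · rw [Set.mem_preimage, Function.comp_apply, h2]
        exact mem_of_mem_nhds hs
      · by_cases hm : (u n).toX ∈ XPlus q
        · exact hM _ ((le_max_left _ _).trans h2.le) ⟨(u n).toX, hm⟩ rfl
        · rw [Set.mem_preimage, Function.comp_apply, eq_infty_of_notMem hm]
          exact mem_of_mem_nhds hs
  · rintro ⟨hc, C, hC⟩
    refine ⟨SeqContinuous.continuous fun u U h => ?_, ⟨C, fun U => hC _⟩, ?_⟩
    · have hmem : ∀ V : XPlus q, (ofPlus V).toX ∈ XPlus q := fun V => V.2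
      have hX : Tendsto (fun n => (ofPlus (u n)).toX) atTop (𝓝 (ofPlus U).toX) :=
        (continuous_subtype_val.tendsto U).comp h
      have h1 : Tendsto (fun n => ofPlus (u n)) atTop (𝓝 (ofPlus U)) :=
        (tendsto_iff_of_mem hd hq3 hq6 (hmem U)).mpr ⟨Eventually.of_forall fun n => hmem _, hX⟩
      exact (hc.tendsto _).comp h1
    -- The filter of large sizes is countably generated, so sequences suffice, and along them the
    -- points converge to `U_∞` in `d`.
    · refine tendsto_of_seq_tendsto fun u hu => ?_
      rw [tendsto_comap_iff] at hu
      have h1 : Tendsto (fun n => ofPlus (u n)) atTop (𝓝 (infty q)) := by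
        rw [tendsto_infty_iff hd hq2, tendsto_weight_zero_iff]
        intro M _
        obtain ⟨N, hN⟩ := eventually_atTop.mp (hu.eventually (eventually_gt_atTop M))
        exact ⟨N, fun n hn => Or.inr (hN n hn)⟩
      exact (hc.tendsto _).comp h1

end Convergence

theorem mainTheorem3 (q : ℝ≥0∞) [Fact (1 ≤ q)] (hq3 : 3 < q) (hq6 : q ≤ 6)
    (e : HilbertBasis (Fin 5 → ℤ) ℂ L2C5)
    (he : ∀ k, IsTrigPoly (e k : T3 → EuclideanSpace ℂ (Fin 5))) :
    (∀ U V : XPlusInf q, Summable (phaseTerm e U V)) ∧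
    ∃ m : MetricSpace (XPlusInf q),
      (∀ U V : XPlusInf q, dist U V = phaseDist e U V) ∧
      PolishSpace (XPlusInf q) ∧
      (∀ (u : ℕ → XPlusInf q) (U : XPlusInf q), U.toX ∈ XPlus q →
        (Tendsto u atTop (𝓝 U) ↔
          (∀ᶠ n in atTop, (u n).toX ∈ XPlus q) ∧
            Tendsto (fun n => (u n).toX) atTop (𝓝 U.toX))) ∧
      (∀ u : ℕ → XPlusInf q,
        (Tendsto u atTop (𝓝 (XPlusInf.infty q)) ↔
          ∀ M : ℝ, 0 < M → ∃ N : ℕ, ∀ n ≥ N,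
            u n = XPlusInf.infty q ∨ M < (u n).toX.size)) ∧
      XPlusInf.classC q =
        {F : XPlusInf q → ℝ | Continuous F ∧ ∃ C : ℝ, ∀ U, |F U| ≤ C} := by
  have hq2 : 2 ≤ q := two_le_of_three_lt hq3
  refine ⟨summable_phaseTerm e, phaseMetric e hq2, ?_⟩
  let _ := phaseMetric e hq2
  have hd : ∀ U V : XPlusInf q, dist U V = phaseDist e U V := fun _ _ => rfl
  exact ⟨hd, XPlusInf.polishSpace hd hq3 hq6, fun u U hU => tendsto_iff_of_mem hd hq3 hq6 hU,
    fun u => (tendsto_infty_iff hd hq2).trans XPlusInf.tendsto_weight_zero_iff,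
    XPlusInf.classC_eq hd hq3 hq6⟩
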